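/- Let $d\ge 1$, $Y=[0,2\pi)^d$, $Y'=[-\tfrac12,\tfrac12)^d$. Let $A=(a_{jk})$ be a symmetric matrix of real, measurable, $2\pi\mathbb{Z}^d$-periodic functions on $\mathbb{R}^d$ with $|a_{jk}|\le\beta$ and $A(y)\zeta\cdot\zeta\ge\alpha|\zeta|^2$ for a.e. $y$ and all $\zeta\in\mathbb{R}^d$, where $\alpha>0$. For $\rho>0$ and $\eta\in Y'$ let $\lambda_1^\rho(\eta)\le\lambda_2^\rho(\eta)\le\dots$ be the eigenvalues, counted with multiplicity, of $$\rho^2(\nabla+i\eta)^4\phi-(\nabla+i\eta)\cdot A(\nabla+i\eta)\phi=\lambda\phi$$ (in the weak sense, on $Y$-periodic $H^2$ functions), and let $\phi_m^\rho(\cdot;\eta)$, $m\ge1$, be corresponding eigenfunctions, chosen measurably in $\eta$ and forming an orthonormal basis of $L^2(Y)$. For $\kappa,\epsilon>0$ put $\rho=\kappa/\epsilon$ and $\phi_m^{\kappa,\epsilon}(x;\xi)=\phi_m^\rho(x/\epsilon;\epsilon\xi)$ for $\xi\in\epsilon^{-1}Y'$, and for $g\in L^2(\mathbb{R}^d)$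 let $$\mathcal{B}_m^{\kappa,\epsilon}g(\xi)=\int_{\mathbb{R}^d}g(x)e^{-ix\cdot\xi}\,\overline{\phi_m^{\kappa,\epsilon}(x;\xi)}\,dx,$$ the integral being the limit in $L^2(\epsilon^{-1}Y')$ as $R\to\infty$ of the integrals over $\{|x|<R\}$. Proposition 8.1 (Contribution of higher modes). For every $M$ there is a constant $c>0$, depending only on $d,\alpha,\beta,M$ (and not on $\epsilon,\kappa$), such that the following holds for all $A$ as above and all $\epsilon,\kappa>0$. Let $f\in L^2(\mathbb{R}^d)$ and let $u^\epsilon\in H^2(\mathbb{R}^d)$ satisfy $$\kappa^2\Delta^2u^\epsilon-\nabla\cdot A(x/\epsilon)\nabla u^\epsilon=f\quad\text{in }\mathbb{R}^d,\qquad \|u^\epsilon\|_{H^1(\mathbb{R}^d)}\le M,\quad \kappa\|\Delta u^\epsilon\|_{L^2(\mathbb{R}^d)}\le M.$$ Then the Bloch coefficients $\mathcal{B}_m^{\kappa,\epsilon}u^\epsilon$, $m\ge 1$, exist, the series $$v^{\kappa,\epsilon}(x)=\int_{\epsilon^{-1}Y'}\sum_{m=2}^\infty\mathcal{B}_m^{\kappa,\epsilon}u^\epsilon(\xi)\,\phi_m^{\kappa,\epsilon}(x;\xi)\,e^{ix\cdot\xi}\,d\xi$$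 converges (its partial sums converge in $L^2(\mathbb{R}^d)$), and $$\|v^{\kappa,\epsilon}\|_{L^2(\mathbb{R}^d)}\le c\,\epsilon .$$ -/

import Mathlib

open MeasureTheory Filter Topology ComplexConjugate
open scoped ENNReal SchwartzMap LineDeriv Laplacian TemperedDistribution

namespace BlochHom

noncomputable section

/-- Euclidean space `ℝ^d`. -/
abbrev E (d : ℕ) : Type := EuclideanSpace ℝ (Fin d)

/-- The complex Lebesgue space `L²(ℝ^d)`. -/
abbrev L2 (d : ℕ) : Type := Lp ℂ 2 (volume : Measure (E d))

/-! ### Coefficients -/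

/-- `A` has real, measurable entries bounded by `β`; it is elliptic with constant `α > 0`, periodic
with period `2π` in each coordinate, and symmetric. -/
structure IsAdmissible {d : ℕ} (α β : ℝ) (A : E d → Matrix (Fin d) (Fin d) ℝ) : Prop where
  measurable : ∀ j k, AEMeasurable (fun y => A y j k) volume
  bounded : ∀ᵐ y, ∀ j k, |A y j k| ≤ β
  pos : 0 < α
  elliptic : ∀ᵐ y, ∀ ζ : Fin d → ℝ, α * ∑ j, ζ j ^ 2 ≤ ∑ j, ∑ k, A y j k * ζ k * ζ j
  periodic : ∀ p : Fin d → ℤ,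
    ∀ᵐ y, A (y + WithLp.toLp 2 (fun j => 2 * Real.pi * (p j : ℝ))) = A y
  symm : ∀ᵐ y, (A y).IsSymm

/-! ### The equation on the whole space -/

/-- `g ∈ L²` is the distributional partial derivative `∂u/∂x_j` of `u ∈ L²`. -/
def IsPartial {d : ℕ} (j : Fin d) (u g : L2 d) : Prop :=
  (g : 𝓢'(E d, ℂ)) = ∂_{EuclideanSpace.single j (1 : ℝ)} (u : 𝓢'(E d, ℂ))

/-- `g ∈ L²` is the distributional Laplacian of `u ∈ L²`. -/
def IsLaplacian {d : ℕ} (u g : L2 d) : Prop :=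
  (g : 𝓢'(E d, ℂ)) = Δ (u : 𝓢'(E d, ℂ))

/-- `u ∈ H²(ℝ^d)` solves `κ² Δ² u - ∇ · A(x/ε) ∇u = f` in `ℝ^d` in the sense of distributions.
Here `G` is the gradient of `u` and `F` is the flux `A(x/ε) ∇u`. -/
def IsSolution {d : ℕ} (A : E d → Matrix (Fin d) (Fin d) ℝ) (κ ε : ℝ) (f u : L2 d) : Prop :=
  TemperedDistribution.MemSobolev 2 2 (u : 𝓢'(E d, ℂ)) ∧
  ∃ G F : Fin d → L2 d,
    (∀ j, IsPartial j u (G j)) ∧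
    (∀ j, ∀ᵐ x, F j x = ∑ k, (A (ε⁻¹ • x) j k : ℂ) * G k x) ∧
    ((κ : ℂ) ^ 2) • Δ (Δ (u : 𝓢'(E d, ℂ)))
        - ∑ j, ∂_{EuclideanSpace.single j (1 : ℝ)} (F j : 𝓢'(E d, ℂ))
      = (f : 𝓢'(E d, ℂ))

/-! ### Periodic functions -/

/-- The periodicity cell `Y = [0, 2π)^d`. -/
def cell (d : ℕ) : Set (E d) := {y | ∀ j, y j ∈ Set.Ico 0 (2 * Real.pi)}

/-- The dual cell `Y' = [-1/2, 1/2)^d`. -/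
def dualCell (d : ℕ) : Set (E d) := {η | ∀ j, η j ∈ Set.Ico (-(1 / 2) : ℝ) (1 / 2)}

/-- The exponential `y ↦ e^{i n · y}`. -/
def expMode {d : ℕ} (n : Fin d → ℤ) (y : E d) : ℂ :=
  Complex.exp (Complex.I * ((∑ j, (n j : ℝ) * y j : ℝ) : ℂ))

theorem volume_cell_lt_top (d : ℕ) : (volume : Measure (E d)) (cell d) < ⊤ := by
  refine lt_of_le_of_lt (measure_mono (t := Metric.closedBall (0 : E d)
    (Real.sqrt (∑ _j : Fin d, (2 * Real.pi) ^ 2))) ?_) measure_closedBall_lt_top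
  intro y hy
  rw [mem_closedBall_zero_iff, EuclideanSpace.norm_eq]
  apply Real.sqrt_le_sqrt
  apply Finset.sum_le_sum
  intro j _
  have h := hy j
  rw [Real.norm_eq_abs, sq_abs]
  exact pow_le_pow_left₀ h.1 h.2.le 2

theorem memLp_expMode {d : ℕ} (n : Fin d → ℤ) :
    MemLp (expMode n) 2 ((volume : Measure (E d)).restrict (cell d)) := by
  have : IsFiniteMeasure ((volume : Measure (E d)).restrict (cell d)) :=
    ⟨by simpa using volume_cell_lt_top d⟩
  have hc : Continuous (expMode n : E d → ℂ) := by
    unfold expMode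
    fun_prop
  refine MemLp.of_bound hc.aestronglyMeasurable 1 (Eventually.of_forall fun y => ?_)
  unfold expMode
  rw [mul_comm, Complex.norm_exp_ofReal_mul_I]

/-- The `n`-th Fourier coefficient `(2π)^{-d} ∫_Y u(y) e^{-i n · y} dy` of a periodic function. -/
def fourierCoeffPer {d : ℕ} (u : E d → ℂ) (n : Fin d → ℤ) : ℂ :=
  (((2 * Real.pi) ^ d : ℝ) : ℂ)⁻¹ * ∫ y in cell d, u y * conj (expMode n y)

/-- The `L²(Y)`-sum of the Fourier series `∑ₙ c(n) e^{i n · y}`. -/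
def fourierSeries {d : ℕ} (c : (Fin d → ℤ) → ℂ) :
    Lp ℂ 2 ((volume : Measure (E d)).restrict (cell d)) :=
  ∑' n, c n • (memLp_expMode n).toLp (expMode n)

/-- `u` belongs to the space of `Y`-periodic `H²` functions: it is periodic, square integrable on
`Y`, and `∑ₙ (1 + |n|²)² |û(n)|²` is finite. -/
structure MemH2Per {d : ℕ} (u : E d → ℂ) : Prop where
  periodic : ∀ p : Fin d → ℤ,
    ∀ᵐ y, u (y + WithLp.toLp 2 (fun j => 2 * Real.pi * (p j : ℝ))) = u y
  memLp : MemLp u 2 (volume.restrict (cell d))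
  summable : Summable fun n : Fin d → ℤ =>
    (1 + ∑ j, (n j : ℝ) ^ 2) ^ 2 * ‖fourierCoeffPer u n‖ ^ 2

/-- The `j`-th component of `(∇ + iη)u` on `Y`, for periodic `u`: the periodic function with
Fourier coefficients `i (n_j + η_j) û(n)`. -/
def shiftedPartial {d : ℕ} (η : E d) (j : Fin d) (u : E d → ℂ) :
    Lp ℂ 2 ((volume : Measure (E d)).restrict (cell d)) :=
  fourierSeries fun n => Complex.I * (((n j : ℝ) + η j : ℝ) : ℂ) * fourierCoeffPer u n

/-- `(∇ + iη)²u` on `Y`, for periodic `u`: the periodic function with Fourier coefficients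
`-|n + η|² û(n)`. -/
def shiftedLaplacian {d : ℕ} (η : E d) (u : E d → ℂ) :
    Lp ℂ 2 ((volume : Measure (E d)).restrict (cell d)) :=
  fourierSeries fun n => -((∑ j, ((n j : ℝ) + η j) ^ 2 : ℝ) : ℂ) * fourierCoeffPer u n

/-- The sesquilinear form
`∫_Y A (∇+iη)u · conj((∇+iη)v) dy + ρ² ∫_Y (∇+iη)²u conj((∇+iη)²v) dy`. -/
def shiftedForm {d : ℕ} (A : E d → Matrix (Fin d) (Fin d) ℝ) (ρ : ℝ) (η : E d)
    (u v : E d → ℂ) : ℂ :=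
  (∫ y in cell d, ∑ j, ∑ k,
      (A y j k : ℂ) * shiftedPartial η k u y * conj (shiftedPartial η j v y))
    + (ρ : ℂ) ^ 2 * ∫ y in cell d, shiftedLaplacian η u y * conj (shiftedLaplacian η v y)

/-! ### Bloch waves -/

/-- `(lam m η, φ m · η)`, `η ∈ Y'`, are the Bloch eigenvalues and eigenfunctions of
`ρ² Δ² - ∇ · A ∇`, numbered from `0` (so index `m` is the `(m+1)`-st mode): for each `η ∈ Y'` the
`lam m η` are the eigenvalues, in nondecreasing order and repeated with multiplicity, of
`ρ² (∇+iη)⁴ φ - (∇+iη) · A (∇+iη) φ = λ φ` (weakly, on periodic `H²` functions), and the `φ m · η`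
are corresponding eigenfunctions, chosen measurably, forming an orthonormal basis of `L²(Y)`. -/
structure IsBlochSystem {d : ℕ} (A : E d → Matrix (Fin d) (Fin d) ℝ) (ρ : ℝ)
    (lam : ℕ → E d → ℝ) (φ : ℕ → E d → E d → ℂ) : Prop where
  measurable : ∀ m, AEStronglyMeasurable (fun z : E d × E d => φ m z.1 z.2)
    (volume.prod (volume.restrict (dualCell d)))
  memH2 : ∀ η ∈ dualCell d, ∀ m, MemH2Per (fun y => φ m y η)
  eigen : ∀ η ∈ dualCell d, ∀ m, ∀ ψ : E d → ℂ, MemH2Per ψ →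
    shiftedForm A ρ η (fun y => φ m y η) ψ
      = (lam m η : ℂ) * ∫ y in cell d, φ m y η * conj (ψ y)
  mono : ∀ η ∈ dualCell d, Monotone fun m => lam m η
  orthonormal : ∀ η ∈ dualCell d, ∀ m n,
    ∫ y in cell d, φ m y η * conj (φ n y η) = if m = n then 1 else 0
  complete : ∀ η ∈ dualCell d, ∀ ψ : E d → ℂ, MemLp ψ 2 (volume.restrict (cell d)) →
    (∀ m, ∫ y in cell d, ψ y * conj (φ m y η) = 0) → ∀ᵐ y ∂(volume.restrict (cell d)), ψ y = 0

/-- The scaled dual cell `ε⁻¹ Y'`. -/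
def scaledDualCell (d : ℕ) (ε : ℝ) : Set (E d) := {ξ | ε • ξ ∈ dualCell d}

/-- The Bloch eigenfunction at scale `ε`, `x, ξ ↦ φ(x/ε; εξ)`. -/
def scaledMode {d : ℕ} (ε : ℝ) (φ : E d → E d → ℂ) (x ξ : E d) : ℂ := φ (ε⁻¹ • x) (ε • ξ)

/-- The plane wave `e^{i x · ξ}`. -/
def planeWave {d : ℕ} (x ξ : E d) : ℂ :=
  Complex.exp (Complex.I * ((∑ j, x j * ξ j : ℝ) : ℂ))

/-- `B` is the Bloch coefficient `ξ ↦ ∫ g(x) e^{-i x · ξ} conj(φ(x/ε; εξ)) dx` of `g ∈ L²(ℝ^d)`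
for the mode `φ`. As for the Fourier transform, the integral over `ℝ^d` is the limit in
`L²(ε⁻¹ Y')` of the integrals over balls. This determines `B` almost everywhere on `ε⁻¹ Y'`. -/
def IsBlochCoeff {d : ℕ} (ε : ℝ) (φ : E d → E d → ℂ) (g : L2 d) (B : E d → ℂ) : Prop :=
  MemLp B 2 (volume.restrict (scaledDualCell d ε)) ∧
  Tendsto (fun R : ℝ => eLpNorm
      (fun ξ => (∫ x in Metric.ball (0 : E d) R,
        g x * conj (planeWave x ξ) * conj (scaledMode ε φ x ξ)) - B ξ)
      2 (volume.restrict (scaledDualCell d ε)))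
    atTop (𝓝 0)

/-- `v(x) = ∫_{ε⁻¹ Y'} ∑_{m ≥ 1} B m ξ φ_m(x/ε; εξ) e^{i x · ξ} dξ`, the sum over all modes other
than the first one (which has index `0`), as the limit in `L²(ℝ^d)` of the partial sums. This
determines `v` as an element of `L²(ℝ^d)`. -/
def IsHigherModePart {d : ℕ} (ε : ℝ) (φ : ℕ → E d → E d → ℂ) (B : ℕ → E d → ℂ) (v : L2 d) :
    Prop :=
  Tendsto (fun N : ℕ => eLpNorm
      (fun x => (∫ ξ in scaledDualCell d ε,
        ∑ m ∈ Finset.Icc 1 N, B m ξ * scaledMode ε (φ m) x ξ * planeWave x ξ) - v x)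
      2 (volume : Measure (E d)))
    atTop (𝓝 0)

end

end BlochHom

/-!
The fiber of `u` at `ξ` is the periodic function `y ↦ ∑ₙ û(ξ + n/ε) e^{i n · y}`, suitably
normalised. The Bloch coefficient `B_m(ξ)` is its inner product with `φ_m(·; εξ)`, and `∇ + iη` at
`η = εξ` acts on fibers as `ε∇` on `u`. Hence the integral over `ξ` of the Bloch form evaluated on
the fibers is at most `ε²` times the energy of `u`. By Bessel's inequality for the form, it bounds
`∑ₘ ∫ λ_m |B_m|²`. Two orthonormal modes span a nonzero function without constant Fourier mode, so
Poincaré's inequality gives `λ_m ≥ α/4` for every mode but the first, and `∑ₘ ‖B_m‖² ≤ C ε²`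
follows. Finally, the contribution of the `m`-th mode to the Bloch expansion is `T_m† B_m`, where
`T_m : L²(ℝ^d) → L²(ε⁻¹Y')` is the `m`-th Bloch transform; since `∑ₘ ‖T_m u‖² ≤ ‖u‖²`, by duality
the series converges and its norm is at most `(∑ₘ ‖B_m‖²)^{1/2}`.
-/

namespace BlochHom

open scoped FourierTransform

noncomputable section

/-! ### Fourier series on the periodicity cell -/

/-- Lebesgue measure on the periodicity cell `Y`. -/
abbrev cellMeasure (d : ℕ) : Measure (E d) := volume.restrict (cell d)

/-- The volume `(2π)^d` of the periodicity cell. -/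
def cellVol (d : ℕ) : ℝ := (2 * Real.pi) ^ d

lemma cellVol_pos (d : ℕ) : 0 < cellVol d := by unfold cellVol; positivity

lemma cellVol_ne_zero (d : ℕ) : (cellVol d : ℂ) ≠ 0 := by exact_mod_cast (cellVol_pos d).ne'

lemma cell_eq_preimage_pi (d : ℕ) :
    cell d = WithLp.ofLp ⁻¹' Set.univ.pi fun _ : Fin d => Set.Ico (0 : ℝ) (2 * Real.pi) := by
  ext y; simp [cell]

lemma measurableSet_cell (d : ℕ) : MeasurableSet (cell d) := by
  rw [cell_eq_preimage_pi]
  exact (PiLp.volume_preserving_ofLp (Fin d)).measurable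
    (MeasurableSet.univ_pi fun _ => measurableSet_Ico)

lemma continuous_expMode {d : ℕ} (n : Fin d → ℤ) : Continuous (expMode n : E d → ℂ) := by
  unfold expMode
  fun_prop

section Torus

variable {d : ℕ}

local instance unitAddCircleMeasureSpace : MeasureSpace UnitAddCircle :=
  ⟨AddCircle.haarAddCircle⟩

local instance : Measure.IsAddHaarMeasure (volume : Measure UnitAddCircle) :=
  inferInstanceAs (Measure.IsAddHaarMeasure AddCircle.haarAddCircle)

local instance : IsProbabilityMeasure (volume : Measure UnitAddCircle) :=
  inferInstanceAs (IsProbabilityMeasure AddCircle.haarAddCircle)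

/-- The measurable section, with values in the cell up to a null set, of the covering map
`y ↦ y / 2π` from `ℝ^d` to the unit torus. It transfers Fourier series from the torus to the
cell. -/
def torusSection (d : ℕ) (t : UnitAddTorus (Fin d)) : E d :=
  (2 * Real.pi) • WithLp.toLp 2 (fun i => (AddCircle.equivIoc 1 0 (t i)).1)

lemma Ioc_ae_eq_cell (d : ℕ) :
    (WithLp.ofLp ⁻¹' Set.univ.pi fun _ : Fin d => Set.Ioc (0 : ℝ) (2 * Real.pi))
      =ᵐ[volume] cell d := by
  rw [cell_eq_preimage_pi]
  exact (PiLp.volume_preserving_ofLp (Fin d)).quasiMeasurePreserving.preimage_ae_eq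
    (Measure.univ_pi_Ioc_ae_eq_Icc.trans Measure.univ_pi_Ico_ae_eq_Icc.symm)

lemma measurePreserving_two_pi_smul (d : ℕ) :
    MeasurePreserving (fun y : E d => (2 * Real.pi) • y) volume
      (ENNReal.ofReal (cellVol d)⁻¹ • volume) := by
  refine ⟨by fun_prop, ?_⟩
  rw [Measure.map_addHaar_smul _ (by positivity), finrank_euclideanSpace_fin,
    abs_of_pos (by positivity), cellVol]

lemma measurePreserving_torusSection (d : ℕ) :
    MeasurePreserving (torusSection d) volume
      (ENNReal.ofReal (cellVol d)⁻¹ • cellMeasure d) := by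
  set I : Set (E d) := WithLp.ofLp ⁻¹' Set.univ.pi fun _ => Set.Ioc 0 (2 * Real.pi)
  have hI : MeasurableSet I := (PiLp.volume_preserving_ofLp (Fin d)).measurable
    (MeasurableSet.univ_pi fun _ => measurableSet_Ioc)
  have hscale := ((measurePreserving_two_pi_smul d).comp
    (PiLp.volume_preserving_toLp (Fin d))).restrict_preimage hI
  have hunit : ((fun y : E d => (2 * Real.pi) • y) ∘ WithLp.toLp 2) ⁻¹' I =
      {x : Fin d → ℝ | ∀ i, x i ∈ Set.Ioc ((0 : Fin d → ℝ) i) ((0 : Fin d → ℝ) i + 1)} := by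
    ext x
    simp [I, Real.pi_pos]
  rw [hunit, Measure.restrict_smul, Measure.restrict_congr_set (Ioc_ae_eq_cell d)] at hscale
  exact hscale.comp ((measurePreserving_subtype_coe (MeasurableSet.univ_pi' fun _ =>
    measurableSet_Ioc)).comp (UnitAddTorus.measurePreserving_equivPiIoc 0))

lemma expMode_torusSection (n : Fin d → ℤ) (t : UnitAddTorus (Fin d)) :
    expMode n (torusSection d t) = UnitAddTorus.mFourier n t := by
  have hlift : ∀ i, ((AddCircle.equivIoc (1 : ℝ) 0 (t i)).1 : UnitAddCircle) = t i := fun i =>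
    (AddCircle.equivIoc (1 : ℝ) 0).symm_apply_apply (t i)
  have hprod : UnitAddTorus.mFourier n t =
      ∏ i, fourier (n i) (((AddCircle.equivIoc (1 : ℝ) 0 (t i)).1 : ℝ) : UnitAddCircle) := by
    simp only [hlift]; rfl
  rw [hprod]
  simp only [fourier_coe_apply, ← Complex.exp_sum, expMode, torusSection, PiLp.smul_apply]
  push_cast
  rw [Finset.mul_sum]
  congr 1
  refine Finset.sum_congr rfl fun i _ => ?_
  simp
  ring

lemma integral_torusSection {f : E d → ℂ} (hf : AEStronglyMeasurable f (cellMeasure d)) :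
    ∫ t, f (torusSection d t) = (cellVol d : ℂ)⁻¹ * ∫ y in cell d, f y := by
  have hp := measurePreserving_torusSection d
  rw [← integral_map hp.measurable.aemeasurable (by rw [hp.map_eq]; exact hf.smul_measure _),
    hp.map_eq, integral_smul_measure,
    ENNReal.toReal_ofReal (inv_nonneg.mpr (cellVol_pos d).le), Complex.real_smul,
    Complex.ofReal_inv]

lemma integral_expMode_mul_conj (m n : Fin d → ℤ) :
    ∫ y in cell d, expMode n y * conj (expMode m y) = if m = n then (cellVol d : ℂ) else 0 := by
  have htorus : ∫ t : UnitAddTorus (Fin d),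
      UnitAddTorus.mFourier n t * conj (UnitAddTorus.mFourier m t) = if m = n then 1 else 0 := by
    have h := orthonormal_iff_ite.mp (UnitAddTorus.orthonormal_mFourier (d := Fin d)) m n
    rwa [ContinuousMap.inner_toLp] at h
  have hcont : Continuous fun y => expMode n y * conj (expMode m y) := by
    have := continuous_expMode n
    have := continuous_expMode m
    fun_prop
  have h := integral_torusSection (d := d) hcont.aestronglyMeasurable
  simp only [expMode_torusSection] at h
  rw [htorus, eq_comm, inv_mul_eq_iff_eq_mul₀ (cellVol_ne_zero d)] at h
  rw [h, mul_ite, mul_one, mul_zero]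

lemma mFourierCoeff_comp_torusSection {u : E d → ℂ}
    (hu : AEStronglyMeasurable u (cellMeasure d)) (n : Fin d → ℤ) :
    UnitAddTorus.mFourierCoeff (u ∘ torusSection d) n = fourierCoeffPer u n := by
  have hmeas : AEStronglyMeasurable (fun y => u y * conj (expMode n y)) (cellMeasure d) :=
    hu.mul (Complex.continuous_conj.comp (continuous_expMode n)).aestronglyMeasurable
  rw [fourierCoeffPer, ← cellVol, ← integral_torusSection hmeas]
  refine integral_congr_ae (Eventually.of_forall fun t => ?_)
  beta_reduce
  rw [UnitAddTorus.mFourier_neg, ← expMode_torusSection, smul_eq_mul, mul_comm]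
  rfl

lemma ae_eq_zero_of_fourierCoeffPer_eq_zero {u : E d → ℂ} (hu : MemLp u 2 (cellMeasure d))
    (h : ∀ n, fourierCoeffPer u n = 0) : u =ᵐ[cellMeasure d] 0 := by
  have hp := measurePreserving_torusSection d
  have hV : ENNReal.ofReal (cellVol d)⁻¹ ≠ 0 := by simpa using cellVol_pos d
  have hu' : MemLp u 2 (ENNReal.ofReal (cellVol d)⁻¹ • cellMeasure d) :=
    hu.smul_measure ENNReal.ofReal_ne_top
  have hw : MemLp (u ∘ torusSection d) 2 volume := hu'.comp_measurePreserving hp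
  have hcoeff : ∀ n, UnitAddTorus.mFourierCoeff (hw.toLp _) n = 0 := fun n => by
    rw [← h n, ← mFourierCoeff_comp_torusSection hu.1]
    exact integral_congr_ae (by filter_upwards [hw.coeFn_toLp] with t ht; rw [ht])
  have hzero : hw.toLp _ = 0 := by
    have hsum := UnitAddTorus.hasSum_mFourier_series_L2 (hw.toLp _)
    simp only [hcoeff, zero_smul] at hsum
    exact hsum.unique hasSum_zero
  have hnorm : eLpNorm u 2 (ENNReal.ofReal (cellVol d)⁻¹ • cellMeasure d) = 0 := by
    rw [← eLpNorm_comp_measurePreserving hu'.1 hp, ← Lp.enorm_toLp (hf := hw), hzero, enorm_zero]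
  rw [eLpNorm_eq_zero_iff hu'.1 two_ne_zero] at hnorm
  exact (Measure.ae_ennreal_smul_measure_iff hV).mp hnorm

end Torus

section CellBasis

lemma inner_toLp {X : Type*} [MeasurableSpace X] {μ : Measure X} {u v : X → ℂ}
    (hu : MemLp u 2 μ) (hv : MemLp v 2 μ) :
    inner ℂ (hu.toLp u) (hv.toLp v) = ∫ x, v x * conj (u x) ∂μ := by
  rw [L2.inner_def]
  refine integral_congr_ae ?_
  filter_upwards [hu.coeFn_toLp, hv.coeFn_toLp] with x hux hvx
  rw [hux, hvx, RCLike.inner_apply]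

variable {d : ℕ}

/-- The exponential `e^{i n · y}` as an element of `L²(Y)`. -/
def expLp (n : Fin d → ℤ) : Lp ℂ 2 (cellMeasure d) := (memLp_expMode n).toLp (expMode n)

lemma fourierCoeffPer_congr {u v : E d → ℂ} (h : u =ᵐ[cellMeasure d] v) (n : Fin d → ℤ) :
    fourierCoeffPer u n = fourierCoeffPer v n := by
  unfold fourierCoeffPer
  congr 1
  exact integral_congr_ae (by filter_upwards [h] with y hy; rw [hy])

lemma inner_expLp (m n : Fin d → ℤ) :
    inner ℂ (expLp m) (expLp n) = if m = n then (cellVol d : ℂ) else 0 := by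
  rw [expLp, expLp, inner_toLp, integral_expMode_mul_conj]

lemma inner_expLp_toLp (n : Fin d → ℤ) {u : E d → ℂ} (hu : MemLp u 2 (cellMeasure d)) :
    inner ℂ (expLp n) (hu.toLp u) = cellVol d * fourierCoeffPer u n := by
  rw [expLp, inner_toLp, fourierCoeffPer, ← cellVol, mul_inv_cancel_left₀ (cellVol_ne_zero d)]

lemma sqrt_cellVol_ne_zero (d : ℕ) : (√(cellVol d) : ℂ) ≠ 0 := by
  exact_mod_cast (Real.sqrt_pos.mpr (cellVol_pos d)).ne'

lemma sqrt_cellVol_mul_self (d : ℕ) : (√(cellVol d) : ℂ) * √(cellVol d) = cellVol d := by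
  rw [← Complex.ofReal_mul, Real.mul_self_sqrt (cellVol_pos d).le]

lemma orthonormal_expLp (d : ℕ) :
    Orthonormal ℂ fun n : Fin d → ℤ => ((√(cellVol d))⁻¹ : ℂ) • expLp n := by
  rw [orthonormal_iff_ite]
  intro m n
  rw [inner_smul_left, inner_smul_right, inner_expLp, map_inv₀, Complex.conj_ofReal,
    ← sqrt_cellVol_mul_self]
  have := sqrt_cellVol_ne_zero d
  split_ifs
  · field_simp
  · simp

lemma eq_zero_of_inner_expLp_eq_zero {w : Lp ℂ 2 (cellMeasure d)}
    (h : ∀ n, inner ℂ (expLp n) w = 0) : w = 0 := by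
  refine Lp.eq_zero_iff_ae_eq_zero.mpr
    (ae_eq_zero_of_fourierCoeffPer_eq_zero (Lp.memLp w) fun n => ?_)
  have hn := h n
  rw [← Lp.toLp_coeFn w (Lp.memLp w), inner_expLp_toLp] at hn
  exact (mul_eq_zero.mp hn).resolve_left (cellVol_ne_zero d)

/-- The normalised exponentials `(2π)^{-d/2} e^{i n · y}` as a Hilbert basis of `L²(Y)`. -/
def cellBasis (d : ℕ) : HilbertBasis (Fin d → ℤ) ℂ (Lp ℂ 2 (cellMeasure d)) :=
  HilbertBasis.mkOfOrthogonalEqBot (orthonormal_expLp d) <|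
    (Submodule.eq_bot_iff _).mpr fun _ hw => eq_zero_of_inner_expLp_eq_zero fun n => by
      have hn := hw _ (Submodule.subset_span (Set.mem_range_self n))
      rw [inner_smul_left] at hn
      exact (mul_eq_zero.mp hn).resolve_left
        ((map_ne_zero _).mpr (inv_ne_zero (sqrt_cellVol_ne_zero d)))

lemma cellBasis_apply (n : Fin d → ℤ) :
    cellBasis d n = ((√(cellVol d))⁻¹ : ℂ) • expLp n := by
  rw [cellBasis, HilbertBasis.coe_mkOfOrthogonalEqBot]

lemma mul_sqrt_smul_cellBasis (a : ℂ) (n : Fin d → ℤ) :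
    (√(cellVol d) * a) • cellBasis d n = a • expLp n := by
  rw [cellBasis_apply, smul_smul, mul_right_comm, mul_inv_cancel₀ (sqrt_cellVol_ne_zero d),
    one_mul]

lemma inner_cellBasis_toLp (n : Fin d → ℤ) {u : E d → ℂ} (hu : MemLp u 2 (cellMeasure d)) :
    inner ℂ (cellBasis d n) (hu.toLp u) = √(cellVol d) * fourierCoeffPer u n := by
  rw [cellBasis_apply, inner_smul_left, inner_expLp_toLp, map_inv₀, Complex.conj_ofReal,
    ← sqrt_cellVol_mul_self, mul_assoc, inv_mul_cancel_left₀ (sqrt_cellVol_ne_zero d)]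

theorem hasSum_fourierCoeffPer_mul_conj {u v : E d → ℂ} (hu : MemLp u 2 (cellMeasure d))
    (hv : MemLp v 2 (cellMeasure d)) :
    HasSum (fun n => (cellVol d : ℂ) * (fourierCoeffPer u n * conj (fourierCoeffPer v n)))
      (∫ y in cell d, u y * conj (v y)) := by
  rw [← inner_toLp hv hu]
  refine ((cellBasis d).hasSum_inner_mul_inner _ _).congr_fun fun n => ?_
  rw [← inner_conj_symm, inner_cellBasis_toLp, inner_cellBasis_toLp, ← sqrt_cellVol_mul_self,
    map_mul, Complex.conj_ofReal]
  ring

theorem hasSum_norm_fourierCoeffPer_sq {u : E d → ℂ} (hu : MemLp u 2 (cellMeasure d)) :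
    HasSum (fun n => cellVol d * ‖fourierCoeffPer u n‖ ^ 2) (‖hu.toLp u‖ ^ 2) := by
  have h := hasSum_fourierCoeffPer_mul_conj hu hu
  rw [← inner_toLp hu hu, inner_self_eq_norm_sq_to_K] at h
  simp only [Complex.mul_conj'] at h
  rw [← Complex.hasSum_ofReal]
  push_cast
  exact h

theorem hasSum_fourierCoeffPer {u : E d → ℂ} (hu : MemLp u 2 (cellMeasure d)) :
    HasSum (fun n => fourierCoeffPer u n • expLp n) (hu.toLp u) := by
  refine ((cellBasis d).hasSum_repr (hu.toLp u)).congr_fun fun n => ?_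
  rw [HilbertBasis.repr_apply_apply, inner_cellBasis_toLp, mul_sqrt_smul_cellBasis]

theorem hasSum_fourierSeries {c : (Fin d → ℤ) → ℂ} (hc : Summable fun n => ‖c n‖ ^ 2) :
    HasSum (fun n => c n • expLp n) (fourierSeries c) := by
  have hm : Memℓp (fun n => (√(cellVol d) : ℂ) * c n) 2 := by
    rw [memℓp_gen_iff (by norm_num)]
    simpa [mul_pow] using hc.mul_left _
  have h := (cellBasis d).hasSum_repr_symm (⟨_, hm⟩ : lp (fun _ : Fin d → ℤ => ℂ) 2)
  exact (h.congr_fun fun n => (mul_sqrt_smul_cellBasis (c n) n).symm).summable.hasSum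

lemma fourierCoeffPer_fourierSeries {c : (Fin d → ℤ) → ℂ} (hc : Summable fun n => ‖c n‖ ^ 2)
    (n : Fin d → ℤ) : fourierCoeffPer (fourierSeries c) n = c n := by
  have h := (hasSum_fourierSeries hc).mapL (innerSL ℂ (expLp n))
  simp only [innerSL_apply_apply, inner_smul_right, inner_expLp, mul_ite, mul_zero] at h
  have hn := h.unique (hasSum_single n fun m hm => if_neg hm.symm)
  rw [if_pos rfl, ← Lp.toLp_coeFn (fourierSeries c) (Lp.memLp _), inner_expLp_toLp,
    mul_comm (c n)] at hn
  exact mul_left_cancel₀ (cellVol_ne_zero d) hn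

lemma hasSum_norm_fourierSeries_sq {c : (Fin d → ℤ) → ℂ} (hc : Summable fun n => ‖c n‖ ^ 2) :
    HasSum (fun n => cellVol d * ‖c n‖ ^ 2) (‖fourierSeries c‖ ^ 2) := by
  have h := hasSum_norm_fourierCoeffPer_sq (Lp.memLp (fourierSeries c))
  simp only [fourierCoeffPer_fourierSeries hc] at h
  rwa [Lp.toLp_coeFn] at h

lemma fourierSeries_add {b c : (Fin d → ℤ) → ℂ} (hb : Summable fun n => ‖b n‖ ^ 2)
    (hc : Summable fun n => ‖c n‖ ^ 2) :
    fourierSeries (fun n => b n + c n) = fourierSeries b + fourierSeries c := by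
  have h := (hasSum_fourierSeries hb).add (hasSum_fourierSeries hc)
  simp only [← add_smul] at h
  exact h.tsum_eq

lemma fourierSeries_smul (a : ℂ) {c : (Fin d → ℤ) → ℂ} (hc : Summable fun n => ‖c n‖ ^ 2) :
    fourierSeries (fun n => a * c n) = a • fourierSeries c := by
  have h := (hasSum_fourierSeries hc).const_smul a
  simp only [smul_smul] at h
  exact h.tsum_eq

end CellBasis

/-! ### Eigenvalue bounds and the spectral gap -/

section HermitianForm

variable {V H ι : Type*} [AddCommGroup V] [Module ℂ V] [NormedAddCommGroup H]
  [InnerProductSpace ℂ H] {T : V →ₗ[ℂ] H} {Q : V →ₗ⋆[ℂ] V →ₗ[ℂ] ℂ} {φ : ι → V} {lam : ι → ℝ}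

lemma inner_sum_smul_eigenvector (hφ : Orthonormal ℂ (T ∘ φ)) (b : ι → ℂ) {s : Finset ι} {i : ι}
    (hi : i ∈ s) : inner ℂ (T (∑ j ∈ s, b j • φ j)) (T (φ i)) = conj (b i) := by
  simpa only [map_sum, map_smul, Function.comp_apply] using hφ.inner_left_sum b hi

lemma norm_sum_smul_eigenvector_sq (hφ : Orthonormal ℂ (T ∘ φ)) (b : ι → ℂ) (s : Finset ι) :
    ‖T (∑ i ∈ s, b i • φ i)‖ ^ 2 = ∑ i ∈ s, ‖b i‖ ^ 2 := by
  have h := hφ.inner_sum b b s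
  simp only [Function.comp_apply, ← map_smul, ← map_sum, inner_self_eq_norm_sq_to_K,
    Complex.conj_mul'] at h
  exact Complex.ofReal_injective (by push_cast; exact h)

lemma form_sum_smul_eigenvector (heig : ∀ i ψ, Q ψ (φ i) = lam i * inner ℂ (T ψ) (T (φ i)))
    (b : ι → ℂ) (s : Finset ι) (ψ : V) :
    Q ψ (∑ i ∈ s, b i • φ i) = ∑ i ∈ s, lam i * (b i * inner ℂ (T ψ) (T (φ i))) := by
  simp only [map_sum, map_smul, heig, smul_eq_mul, mul_left_comm]

lemma form_sum_smul_eigenvector_self (hφ : Orthonormal ℂ (T ∘ φ))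
    (heig : ∀ i ψ, Q ψ (φ i) = lam i * inner ℂ (T ψ) (T (φ i))) (b : ι → ℂ) (s : Finset ι) :
    (Q (∑ i ∈ s, b i • φ i) (∑ i ∈ s, b i • φ i)).re = ∑ i ∈ s, lam i * ‖b i‖ ^ 2 := by
  rw [form_sum_smul_eigenvector heig, Complex.re_sum]
  refine Finset.sum_congr rfl fun i hi => ?_
  rw [inner_sum_smul_eigenvector hφ b hi, Complex.mul_conj']
  norm_cast

theorem sum_eigenvalue_mul_norm_inner_sq_le (hQ : ∀ u v, Q u v = conj (Q v u))
    (hpos : ∀ u, 0 ≤ (Q u u).re) (hφ : Orthonormal ℂ (T ∘ φ))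
    (heig : ∀ i ψ, Q ψ (φ i) = lam i * inner ℂ (T ψ) (T (φ i))) (s : Finset ι) (w : V) :
    ∑ i ∈ s, lam i * ‖inner ℂ (T (φ i)) (T w)‖ ^ 2 ≤ (Q w w).re := by
  set b : ι → ℂ := fun i => inner ℂ (T (φ i)) (T w)
  set p := ∑ i ∈ s, b i • φ i
  have horth : Q (w - p) p = 0 := by
    rw [form_sum_smul_eigenvector heig]
    refine Finset.sum_eq_zero fun i hi => ?_
    rw [map_sub, inner_sub_left, inner_sum_smul_eigenvector hφ b hi, inner_conj_symm, sub_self,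
      mul_zero, mul_zero]
  have hsplit : Q w w = Q (w - p) (w - p) + Q p p := by
    have hsymm : Q p (w - p) = 0 := by rw [hQ, horth, map_zero]
    have hright : Q (w - p) w = Q (w - p) (w - p) := by rw [map_sub (Q (w - p)), horth, sub_zero]
    rw [← hright, map_sub Q, LinearMap.sub_apply, sub_add, ← map_sub (Q p), hsymm, sub_zero]
  rw [hsplit, Complex.add_re, form_sum_smul_eigenvector_self hφ heig]
  exact le_add_of_nonneg_left (hpos _)

theorem le_eigenvalue_of_finrank_lt [Fintype ι] {W : Type*} [AddCommGroup W] [Module ℂ W]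
    [FiniteDimensional ℂ W] (hφ : Orthonormal ℂ (T ∘ φ))
    (heig : ∀ i ψ, Q ψ (φ i) = lam i * inner ℂ (T ψ) (T (φ i))) (ℓ : V →ₗ[ℂ] W)
    (hW : Module.finrank ℂ W < Fintype.card ι) {γ Λ : ℝ} (hΛ : ∀ i, lam i ≤ Λ)
    (hγ : ∀ w, ℓ w = 0 → γ * ‖T w‖ ^ 2 ≤ (Q w w).re) : γ ≤ Λ := by
  obtain ⟨b, hb, hb0⟩ : ∃ b : ι → ℂ, ℓ (∑ i, b i • φ i) = 0 ∧ b ≠ 0 :=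
    (Submodule.ne_bot_iff _).mp <| LinearMap.ker_ne_bot_of_finrank_lt
      (f := ℓ ∘ₗ Fintype.linearCombination ℂ φ) (by rwa [Module.finrank_fintype_fun_eq_card])
  obtain ⟨i, hi⟩ := Function.ne_iff.mp hb0
  have hsum : 0 < ∑ i, ‖b i‖ ^ 2 :=
    Finset.sum_pos' (fun i _ => by positivity) ⟨i, Finset.mem_univ i, by positivity⟩
  refine le_of_mul_le_mul_right ?_ hsum
  calc γ * ∑ i, ‖b i‖ ^ 2 = γ * ‖T (∑ i, b i • φ i)‖ ^ 2 := by
        rw [norm_sum_smul_eigenvector_sq hφ]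
    _ ≤ ∑ i, lam i * ‖b i‖ ^ 2 := by
        rw [← form_sum_smul_eigenvector_self hφ heig]
        exact hγ _ hb
    _ ≤ Λ * ∑ i, ‖b i‖ ^ 2 := by
        rw [Finset.mul_sum]
        gcongr with i
        exact hΛ i

end HermitianForm

section PeriodicSobolev

variable {d : ℕ} {u v : E d → ℂ}

lemma integrable_mul_conj_expMode (hu : MemLp u 2 (cellMeasure d)) (n : Fin d → ℤ) :
    Integrable (fun y => u y * conj (expMode n y)) (cellMeasure d) :=
  hu.integrable_mul (memLp_expMode n).star

lemma fourierCoeffPer_add (hu : MemLp u 2 (cellMeasure d)) (hv : MemLp v 2 (cellMeasure d))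
    (n : Fin d → ℤ) : fourierCoeffPer (u + v) n = fourierCoeffPer u n + fourierCoeffPer v n := by
  unfold fourierCoeffPer
  rw [← mul_add, ← integral_add (integrable_mul_conj_expMode hu n)
    (integrable_mul_conj_expMode hv n)]
  simp only [Pi.add_apply, add_mul]

lemma fourierCoeffPer_smul (a : ℂ) (u : E d → ℂ) (n : Fin d → ℤ) :
    fourierCoeffPer (a • u) n = a * fourierCoeffPer u n := by
  simp only [fourierCoeffPer, Pi.smul_apply, smul_eq_mul, mul_assoc, integral_const_mul,
    mul_left_comm]

lemma norm_add_sq_le_two_mul {F : Type*} [SeminormedAddGroup F] (a b : F) :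
    ‖a + b‖ ^ 2 ≤ 2 * (‖a‖ ^ 2 + ‖b‖ ^ 2) :=
  (pow_le_pow_left₀ (norm_nonneg _) (norm_add_le a b) 2).trans add_sq_le

/-- The space of periodic `H²` functions. Its elements are functions and not classes, as in
`MemH2Per`. -/
def h2Per (d : ℕ) : Submodule ℂ (E d → ℂ) where
  carrier := {u | MemH2Per u}
  zero_mem' :=
    { periodic := fun p => by simp
      memLp := MemLp.zero
      summable := by simp [fourierCoeffPer, summable_zero] }
  add_mem' := by
    intro u v hu hv
    refine ⟨fun p => ?_, hu.memLp.add hv.memLp, ?_⟩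
    · filter_upwards [hu.periodic p, hv.periodic p] with y hyu hyv
      simp only [Pi.add_apply, hyu, hyv]
    · refine Summable.of_nonneg_of_le (fun n => by positivity) (fun n => ?_)
        ((hu.summable.add hv.summable).mul_left 2)
      rw [fourierCoeffPer_add hu.memLp hv.memLp, ← mul_add, mul_left_comm]
      exact mul_le_mul_of_nonneg_left (norm_add_sq_le_two_mul _ _) (by positivity)
  smul_mem' := by
    intro a u hu
    refine ⟨fun p => ?_, hu.memLp.const_smul a, ?_⟩
    · filter_upwards [hu.periodic p] with y hy
      simp only [Pi.smul_apply, hy]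
    · refine (hu.summable.mul_left (‖a‖ ^ 2)).congr fun n => ?_
      rw [fourierCoeffPer_smul, norm_mul]
      ring

/-- The class of a periodic `H²` function in `L²` of the cell. -/
def h2PerToLp (d : ℕ) : h2Per d →ₗ[ℂ] Lp ℂ 2 (cellMeasure d) where
  toFun u := u.2.memLp.toLp u.1
  map_add' u v := MemLp.toLp_add u.2.memLp v.2.memLp
  map_smul' a u := MemLp.toLp_const_smul a u.2.memLp

/-- The `n`-th Fourier coefficient as a linear functional on periodic `H²` functions. -/
def fourierCoeffPerₗ {d : ℕ} (n : Fin d → ℤ) : h2Per d →ₗ[ℂ] ℂ where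
  toFun u := fourierCoeffPer u.1 n
  map_add' u v := fourierCoeffPer_add u.2.memLp v.2.memLp n
  map_smul' a u := fourierCoeffPer_smul a u.1 n

lemma MemH2Per.summable_symbol_mul (hu : MemH2Per u) {σ : (Fin d → ℤ) → ℂ} {C : ℝ}
    (hσ : ∀ n, ‖σ n‖ ≤ C * (1 + ∑ j, (n j : ℝ) ^ 2)) :
    Summable fun n => ‖σ n * fourierCoeffPer u n‖ ^ 2 := by
  refine Summable.of_nonneg_of_le (fun n => by positivity) (fun n => ?_)
    (hu.summable.mul_left (C ^ 2))
  rw [← mul_assoc, ← mul_pow, norm_mul, mul_pow]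
  gcongr
  exact hσ n

/-- The Fourier multiplier with symbol `σ` of order at most two, as a map from periodic `H²`
functions to `L²` of the cell. -/
def fourierMultiplierₗ {d : ℕ} (σ : (Fin d → ℤ) → ℂ) {C : ℝ}
    (hσ : ∀ n, ‖σ n‖ ≤ C * (1 + ∑ j, (n j : ℝ) ^ 2)) : h2Per d →ₗ[ℂ] Lp ℂ 2 (cellMeasure d) where
  toFun u := fourierSeries fun n => σ n * fourierCoeffPer u.1 n
  map_add' u v := by
    rw [← fourierSeries_add (u.2.summable_symbol_mul hσ) (v.2.summable_symbol_mul hσ)]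
    simp only [Submodule.coe_add, fourierCoeffPer_add u.2.memLp v.2.memLp, mul_add]
  map_smul' a u := by
    rw [RingHom.id_apply, ← fourierSeries_smul a (u.2.summable_symbol_mul hσ)]
    simp only [Submodule.coe_smul, fourierCoeffPer_smul, mul_left_comm]

lemma sum_add_sq_le (η : E d) (n : Fin d → ℤ) :
    ∑ j, ((n j : ℝ) + η j) ^ 2 ≤ 2 * (1 + ∑ j, η j ^ 2) * (1 + ∑ j, (n j : ℝ) ^ 2) := by
  have hn : 0 ≤ ∑ j, (n j : ℝ) ^ 2 := by positivity
  have hη : 0 ≤ ∑ j, η j ^ 2 := by positivity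
  calc ∑ j, ((n j : ℝ) + η j) ^ 2 ≤ ∑ j, 2 * ((n j : ℝ) ^ 2 + η j ^ 2) :=
        Finset.sum_le_sum fun j _ => add_sq_le
    _ = 2 * (∑ j, (n j : ℝ) ^ 2 + ∑ j, η j ^ 2) := by
        rw [← Finset.mul_sum, Finset.sum_add_distrib]
    _ ≤ 2 * (1 + ∑ j, η j ^ 2) * (1 + ∑ j, (n j : ℝ) ^ 2) := by
        nlinarith [mul_nonneg hn hη]

lemma norm_shiftedLaplacian_symbol_le (η : E d) (n : Fin d → ℤ) :
    ‖-((∑ j, ((n j : ℝ) + η j) ^ 2 : ℝ) : ℂ)‖ ≤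
      2 * (1 + ∑ j, η j ^ 2) * (1 + ∑ j, (n j : ℝ) ^ 2) := by
  rw [norm_neg, Complex.norm_of_nonneg (by positivity)]
  exact sum_add_sq_le η n

lemma norm_shiftedPartial_symbol (η : E d) (j : Fin d) (n : Fin d → ℤ) :
    ‖Complex.I * (((n j : ℝ) + η j : ℝ) : ℂ)‖ = |(n j : ℝ) + η j| := by
  rw [norm_mul, Complex.norm_I, one_mul, Complex.norm_real, Real.norm_eq_abs]

lemma norm_shiftedPartial_symbol_le (η : E d) (j : Fin d) (n : Fin d → ℤ) :
    ‖Complex.I * (((n j : ℝ) + η j : ℝ) : ℂ)‖ ≤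
      (1 + 2 * (1 + ∑ j, η j ^ 2)) * (1 + ∑ j, (n j : ℝ) ^ 2) := by
  have hn : 0 ≤ ∑ j, (n j : ℝ) ^ 2 := by positivity
  have hle : ((n j : ℝ) + η j) ^ 2 ≤ ∑ j, ((n j : ℝ) + η j) ^ 2 :=
    Finset.single_le_sum (f := fun j => ((n j : ℝ) + η j) ^ 2) (fun i _ => sq_nonneg _)
      (Finset.mem_univ j)
  have habs : |(n j : ℝ) + η j| ≤ 1 + ((n j : ℝ) + η j) ^ 2 := by
    nlinarith [sq_abs ((n j : ℝ) + η j), sq_nonneg (|(n j : ℝ) + η j| - 1)]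
  rw [norm_shiftedPartial_symbol, add_mul]
  linarith [hle.trans (sum_add_sq_le η n)]

/-- `shiftedPartial η j` as a linear map. -/
def shiftedPartialₗ {d : ℕ} (η : E d) (j : Fin d) : h2Per d →ₗ[ℂ] Lp ℂ 2 (cellMeasure d) :=
  fourierMultiplierₗ _ (norm_shiftedPartial_symbol_le η j)

/-- `shiftedLaplacian η` as a linear map. -/
def shiftedLaplacianₗ {d : ℕ} (η : E d) : h2Per d →ₗ[ℂ] Lp ℂ 2 (cellMeasure d) :=
  fourierMultiplierₗ _ (norm_shiftedLaplacian_symbol_le η)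

end PeriodicSobolev

section Form

variable {d : ℕ} {α β : ℝ} {A : E d → Matrix (Fin d) (Fin d) ℝ}

section L2

variable {X : Type*} [MeasurableSpace X] {μ : Measure X}

lemma integrable_norm_Lp_sq (f : Lp ℂ 2 μ) : Integrable (fun x => ‖f x‖ ^ 2) μ :=
  (memLp_two_iff_integrable_sq_norm (Lp.memLp f).1).mp (Lp.memLp f)

lemma norm_Lp_sq (f : Lp ℂ 2 μ) : ‖f‖ ^ 2 = ∫ x, ‖f x‖ ^ 2 ∂μ := by
  rw [← inner_self_eq_norm_sq (𝕜 := ℂ) f, L2.inner_def, ← integral_re (L2.integrable_inner f f)]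
  exact integral_congr_ae (Eventually.of_forall fun x => inner_self_eq_norm_sq (𝕜 := ℂ) (f x))

lemma sum_norm_Lp_sq {ι : Type*} [Fintype ι] (f : ι → Lp ℂ 2 μ) :
    ∑ j, ‖f j‖ ^ 2 = ∫ x, ∑ j, ‖f j x‖ ^ 2 ∂μ := by
  rw [integral_finsetSum _ fun j _ => integrable_norm_Lp_sq (f j)]
  exact Finset.sum_congr rfl fun j _ => norm_Lp_sq (f j)

end L2

section Quadratic

variable {ι : Type*} [Fintype ι] (a : Matrix ι ι ℝ) (z : ι → ℂ)

lemma re_quadratic_eq :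
    (∑ j, ∑ k, (a j k : ℂ) * z k * conj (z j)).re =
      ∑ j, ∑ k, a j k * (z k).re * (z j).re + ∑ j, ∑ k, a j k * (z k).im * (z j).im := by
  simp only [Complex.re_sum, ← Finset.sum_add_distrib]
  simp

lemma mul_sum_norm_sq_le_re_quadratic {a : Matrix ι ι ℝ} {α : ℝ}
    (ha : ∀ ζ : ι → ℝ, α * ∑ j, ζ j ^ 2 ≤ ∑ j, ∑ k, a j k * ζ k * ζ j) :
    α * ∑ j, ‖z j‖ ^ 2 ≤ (∑ j, ∑ k, (a j k : ℂ) * z k * conj (z j)).re := by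
  have hre := ha fun j => (z j).re
  have him := ha fun j => (z j).im
  simp only [re_quadratic_eq, Complex.sq_norm, Complex.normSq_apply, ← sq, Finset.sum_add_distrib,
    mul_add]
  linarith

lemma re_quadratic_le {a : Matrix ι ι ℝ} {b : ℝ} (ha : ∀ j k, |a j k| ≤ b) :
    (∑ j, ∑ k, (a j k : ℂ) * z k * conj (z j)).re ≤ |b| * Fintype.card ι * ∑ j, ‖z j‖ ^ 2 := by
  have hentry : ∀ j k, ‖(a j k : ℂ) * z k * conj (z j)‖ ≤
      |b| * ((‖z k‖ ^ 2 + ‖z j‖ ^ 2) / 2) := fun j k => by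
    rw [norm_mul, norm_mul, Complex.norm_real, Real.norm_eq_abs, RCLike.norm_conj, mul_assoc]
    refine mul_le_mul ((ha j k).trans (le_abs_self b)) ?_ (by positivity) (abs_nonneg b)
    linarith [two_mul_le_add_sq ‖z k‖ ‖z j‖]
  calc (∑ j, ∑ k, (a j k : ℂ) * z k * conj (z j)).re
      ≤ ∑ j, ∑ k, |b| * ((‖z k‖ ^ 2 + ‖z j‖ ^ 2) / 2) :=
        (Complex.re_le_norm _).trans <| (norm_sum_le _ _).trans <| Finset.sum_le_sum fun j _ =>
          (norm_sum_le _ _).trans <| Finset.sum_le_sum fun k _ => hentry j k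
    _ = |b| * Fintype.card ι * ∑ j, ‖z j‖ ^ 2 := by
        simp only [← Finset.mul_sum, ← Finset.sum_div, Finset.sum_add_distrib, Finset.sum_const,
          Finset.card_univ, nsmul_eq_mul]
        ring

end Quadratic

/-- The form `∫_Y A f · conj g dy` of the coefficient field `A` on vector fields of class `L²`. -/
def coeffForm (A : E d → Matrix (Fin d) (Fin d) ℝ) (f g : Fin d → Lp ℂ 2 (cellMeasure d)) : ℂ :=
  ∫ y in cell d, ∑ j, ∑ k, (A y j k : ℂ) * f k y * conj (g j y)

lemma IsAdmissible.integrable_coeffForm (hA : IsAdmissible α β A)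
    (f g : Fin d → Lp ℂ 2 (cellMeasure d)) :
    Integrable (fun y => ∑ j, ∑ k, (A y j k : ℂ) * f k y * conj (g j y)) (cellMeasure d) := by
  refine integrable_finsetSum _ fun j _ => integrable_finsetSum _ fun k _ => ?_
  have hfg : Integrable (fun y => f k y * conj (g j y)) (cellMeasure d) :=
    (Lp.memLp (f k)).integrable_mul (Lp.memLp (g j)).star
  simp only [mul_assoc]
  refine hfg.bdd_mul (c := β)
    (Complex.continuous_ofReal.comp_aestronglyMeasurable
      (hA.measurable j k).restrict.aestronglyMeasurable) ?_
  filter_upwards [ae_restrict_of_ae hA.bounded] with y hy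
  simpa using hy j k

lemma IsAdmissible.coeffForm_conj (hA : IsAdmissible α β A)
    (f g : Fin d → Lp ℂ 2 (cellMeasure d)) : coeffForm A f g = conj (coeffForm A g f) := by
  rw [coeffForm, coeffForm, ← integral_conj]
  refine integral_congr_ae ?_
  filter_upwards [ae_restrict_of_ae hA.symm] with y hy
  simp only [map_sum, map_mul, Complex.conj_conj, Complex.conj_ofReal]
  rw [Finset.sum_comm]
  refine Finset.sum_congr rfl fun j _ => Finset.sum_congr rfl fun k _ => ?_
  rw [hy.apply j k, mul_right_comm]

lemma IsAdmissible.coeffForm_add (hA : IsAdmissible α β A)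
    (f g h : Fin d → Lp ℂ 2 (cellMeasure d)) :
    coeffForm A (f + g) h = coeffForm A f h + coeffForm A g h := by
  rw [coeffForm, coeffForm, coeffForm,
    ← integral_add (hA.integrable_coeffForm _ _) (hA.integrable_coeffForm _ _)]
  refine integral_congr_ae ?_
  filter_upwards [ae_all_iff.mpr fun k => Lp.coeFn_add (f k) (g k)] with y hy
  simp only [Pi.add_apply, hy, mul_add, add_mul, Finset.sum_add_distrib]

lemma coeffForm_smul (A : E d → Matrix (Fin d) (Fin d) ℝ) (a : ℂ)
    (f g : Fin d → Lp ℂ 2 (cellMeasure d)) : coeffForm A (a • f) g = a * coeffForm A f g := by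
  rw [coeffForm, coeffForm, ← integral_const_mul]
  refine integral_congr_ae ?_
  filter_upwards [ae_all_iff.mpr fun k => Lp.coeFn_smul a (f k)] with y hy
  simp only [Pi.smul_apply, hy, smul_eq_mul, Finset.mul_sum, mul_assoc, mul_left_comm a]

lemma IsAdmissible.le_re_coeffForm (hA : IsAdmissible α β A)
    (f : Fin d → Lp ℂ 2 (cellMeasure d)) : α * ∑ j, ‖f j‖ ^ 2 ≤ (coeffForm A f f).re := by
  have hint := hA.integrable_coeffForm f f
  rw [coeffForm, sum_norm_Lp_sq, ← integral_const_mul, ← RCLike.re_to_complex, ← integral_re hint]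
  refine integral_mono_ae
    ((integrable_finsetSum _ fun j _ => integrable_norm_Lp_sq (f j)).const_mul α) hint.re ?_
  filter_upwards [ae_restrict_of_ae hA.elliptic] with y hy
  exact mul_sum_norm_sq_le_re_quadratic (fun j => f j y) hy

lemma IsAdmissible.re_coeffForm_le (hA : IsAdmissible α β A)
    (f : Fin d → Lp ℂ 2 (cellMeasure d)) :
    (coeffForm A f f).re ≤ |β| * d * ∑ j, ‖f j‖ ^ 2 := by
  have hint := hA.integrable_coeffForm f f
  rw [coeffForm, sum_norm_Lp_sq, ← integral_const_mul, ← RCLike.re_to_complex, ← integral_re hint]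
  refine integral_mono_ae hint.re
    ((integrable_finsetSum _ fun j _ => integrable_norm_Lp_sq (f j)).const_mul _) ?_
  filter_upwards [ae_restrict_of_ae hA.bounded] with y hy
  exact (re_quadratic_le (fun j => f j y) hy).trans_eq (by rw [Fintype.card_fin])

lemma shiftedForm_eq (A : E d → Matrix (Fin d) (Fin d) ℝ) (ρ : ℝ) (η : E d) (u v : h2Per d) :
    shiftedForm A ρ η u v =
      coeffForm A (fun j => shiftedPartialₗ η j u) (fun j => shiftedPartialₗ η j v) +
      (ρ : ℂ) ^ 2 * inner ℂ (shiftedLaplacianₗ η v) (shiftedLaplacianₗ η u) := by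
  rw [L2.inner_def]
  rfl

lemma IsAdmissible.shiftedForm_conj (hA : IsAdmissible α β A) (ρ : ℝ) (η : E d)
    (u v : h2Per d) : shiftedForm A ρ η u v = conj (shiftedForm A ρ η v u) := by
  rw [shiftedForm_eq, shiftedForm_eq, map_add, map_mul, inner_conj_symm, map_pow,
    Complex.conj_ofReal, hA.coeffForm_conj]

lemma IsAdmissible.shiftedForm_add (hA : IsAdmissible α β A) (ρ : ℝ) (η : E d)
    (u v w : h2Per d) :
    shiftedForm A ρ η (u + v : h2Per d) w = shiftedForm A ρ η u w + shiftedForm A ρ η v w := by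
  simp only [shiftedForm_eq, map_add, inner_add_right, mul_add]
  rw [add_add_add_comm, ← hA.coeffForm_add]
  rfl

lemma shiftedForm_smul (A : E d → Matrix (Fin d) (Fin d) ℝ) (ρ : ℝ) (η : E d) (a : ℂ)
    (u v : h2Per d) : shiftedForm A ρ η (a • u : h2Per d) v = a * shiftedForm A ρ η u v := by
  simp only [shiftedForm_eq, map_smul, inner_smul_right, mul_add]
  rw [← coeffForm_smul, mul_left_comm]
  rfl

/-- `shiftedForm` on periodic `H²` functions as a sesquilinear map. The variables are exchanged:
it is conjugate linear in the first one. -/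
def IsAdmissible.sesqForm (hA : IsAdmissible α β A) (ρ : ℝ) (η : E d) :
    h2Per d →ₗ⋆[ℂ] h2Per d →ₗ[ℂ] ℂ :=
  LinearMap.mk₂'ₛₗ (starRingEnd ℂ) (RingHom.id ℂ) (fun v u => shiftedForm A ρ η u v)
    (fun v w u => by
      rw [hA.shiftedForm_conj, hA.shiftedForm_add, map_add, ← hA.shiftedForm_conj,
        ← hA.shiftedForm_conj])
    (fun a v u => by
      rw [hA.shiftedForm_conj, shiftedForm_smul, map_mul, ← hA.shiftedForm_conj, smul_eq_mul])
    (fun w u v => hA.shiftedForm_add ρ η u v w)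
    (fun a v u => shiftedForm_smul A ρ η a u v)

lemma re_shiftedForm_self (A : E d → Matrix (Fin d) (Fin d) ℝ) (ρ : ℝ) (η : E d) (u : h2Per d) :
    (shiftedForm A ρ η u u).re =
      (coeffForm A (fun j => shiftedPartialₗ η j u) (fun j => shiftedPartialₗ η j u)).re +
      ρ ^ 2 * ‖shiftedLaplacianₗ η u‖ ^ 2 := by
  rw [shiftedForm_eq, inner_self_eq_norm_sq_to_K, Complex.add_re]
  simp [← Complex.ofReal_pow]

lemma IsAdmissible.le_re_sesqForm (hA : IsAdmissible α β A) (ρ : ℝ) (η : E d) (u : h2Per d) :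
    α * ∑ j, ‖shiftedPartial η j u‖ ^ 2 ≤ (hA.sesqForm ρ η u u).re := by
  refine (hA.le_re_coeffForm fun j => shiftedPartialₗ η j u).trans ?_
  exact (le_add_of_nonneg_right (by positivity)).trans_eq (re_shiftedForm_self A ρ η u).symm

lemma IsAdmissible.re_sesqForm_le (hA : IsAdmissible α β A) (ρ : ℝ) (η : E d) (u : h2Per d) :
    (hA.sesqForm ρ η u u).re ≤
      |β| * d * ∑ j, ‖shiftedPartial η j u‖ ^ 2 + ρ ^ 2 * ‖shiftedLaplacian η u‖ ^ 2 :=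
  (re_shiftedForm_self A ρ η u).trans_le <|
    add_le_add_left (hA.re_coeffForm_le fun j => shiftedPartialₗ η j u) _

lemma IsAdmissible.sesqForm_nonneg (hA : IsAdmissible α β A) (ρ : ℝ) (η : E d) (u : h2Per d) :
    0 ≤ (hA.sesqForm ρ η u u).re :=
  (mul_nonneg hA.pos.le (by positivity)).trans (hA.le_re_sesqForm ρ η u)

end Form

section SpectralGap

variable {d : ℕ} {α β ρ : ℝ} {A : E d → Matrix (Fin d) (Fin d) ℝ} {lam : ℕ → E d → ℝ}
  {φ : ℕ → E d → E d → ℂ} {η : E d}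

lemma hasSum_sum_norm_shiftedPartial_sq (η : E d) (u : h2Per d) :
    HasSum (fun n : Fin d → ℤ =>
        cellVol d * ((∑ j, ((n j : ℝ) + η j) ^ 2) * ‖fourierCoeffPer u n‖ ^ 2))
      (∑ j, ‖shiftedPartial η j u‖ ^ 2) := by
  refine (hasSum_sum fun j _ => hasSum_norm_fourierSeries_sq
    (u.2.summable_symbol_mul (norm_shiftedPartial_symbol_le η j))).congr_fun fun n => ?_
  simp only [norm_mul _ (fourierCoeffPer u.1 n), norm_shiftedPartial_symbol, mul_pow, sq_abs,
    Finset.sum_mul, Finset.mul_sum]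

lemma quarter_le_sum_add_sq (hη : η ∈ dualCell d) {n : Fin d → ℤ} (hn : n ≠ 0) :
    1 / 4 ≤ ∑ j, ((n j : ℝ) + η j) ^ 2 := by
  obtain ⟨j, hj⟩ := Function.ne_iff.mp hn
  refine le_trans ?_ (Finset.single_le_sum (f := fun j => ((n j : ℝ) + η j) ^ 2)
    (fun i _ => sq_nonneg _) (Finset.mem_univ j))
  obtain ⟨hlow, hhigh⟩ := hη j
  rcases Int.lt_or_gt_of_ne hj with hneg | hpos
  · have hn : (n j : ℝ) ≤ -1 := by exact_mod_cast Int.le_sub_one_of_lt hneg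
    nlinarith
  · have hn : (1 : ℝ) ≤ n j := by exact_mod_cast hpos
    nlinarith

theorem norm_sq_le_of_fourierCoeffPer_zero (hη : η ∈ dualCell d) {u : h2Per d}
    (hu : fourierCoeffPerₗ 0 u = 0) :
    ‖h2PerToLp d u‖ ^ 2 ≤ 4 * ∑ j, ‖shiftedPartial η j u‖ ^ 2 := by
  refine hasSum_le (fun n => ?_) (hasSum_norm_fourierCoeffPer_sq u.2.memLp)
    ((hasSum_sum_norm_shiftedPartial_sq η u).mul_left 4)
  rcases eq_or_ne n 0 with rfl | hn
  · have hu' : fourierCoeffPer u.1 0 = 0 := hu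
    simp [hu']
  · rw [mul_left_comm, ← mul_assoc 4]
    refine mul_le_mul_of_nonneg_left (le_mul_of_one_le_left (by positivity) ?_) (cellVol_pos d).le
    linarith [quarter_le_sum_add_sq hη hn]

/-- The Bloch eigenfunctions at `η` as elements of the space of periodic `H²` functions. -/
def IsBlochSystem.mode (hB : IsBlochSystem A ρ lam φ) (hη : η ∈ dualCell d) (m : ℕ) : h2Per d :=
  ⟨fun y => φ m y η, hB.memH2 η hη m⟩

lemma inner_h2PerToLp (u v : h2Per d) :
    inner ℂ (h2PerToLp d u) (h2PerToLp d v) = ∫ y in cell d, v.1 y * conj (u.1 y) :=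
  inner_toLp u.2.memLp v.2.memLp

lemma IsBlochSystem.orthonormal_mode (hB : IsBlochSystem A ρ lam φ) (hη : η ∈ dualCell d) :
    Orthonormal ℂ (h2PerToLp d ∘ hB.mode hη) := by
  refine orthonormal_iff_ite.mpr fun m n => ?_
  exact (inner_h2PerToLp _ _).trans ((hB.orthonormal η hη n m).trans (if_congr eq_comm rfl rfl))

lemma IsBlochSystem.sesqForm_mode (hA : IsAdmissible α β A) (hB : IsBlochSystem A ρ lam φ)
    (hη : η ∈ dualCell d) (m : ℕ) (ψ : h2Per d) :
    hA.sesqForm ρ η ψ (hB.mode hη m) =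
      lam m η * inner ℂ (h2PerToLp d ψ) (h2PerToLp d (hB.mode hη m)) := by
  rw [inner_h2PerToLp]
  exact hB.eigen η hη m ψ.1 ψ.2

-- Two orthonormal modes span a nonzero function of mean zero, to which Poincaré's inequality
-- applies.
theorem IsBlochSystem.le_eigenvalue (hA : IsAdmissible α β A) (hB : IsBlochSystem A ρ lam φ)
    (hη : η ∈ dualCell d) {m : ℕ} (hm : 1 ≤ m) : α / 4 ≤ lam m η := by
  refine le_eigenvalue_of_finrank_lt (ι := Fin 2) (T := h2PerToLp d) (Q := hA.sesqForm ρ η)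
    (φ := fun i => hB.mode hη i) (lam := fun i => lam i η)
    ((hB.orthonormal_mode hη).comp _ Fin.val_injective) (fun i ψ => hB.sesqForm_mode hA hη i ψ)
    (fourierCoeffPerₗ 0) (by simp) (fun i => hB.mono η hη (by omega)) fun w hw => ?_
  have hpoincare := mul_le_mul_of_nonneg_left (norm_sq_le_of_fourierCoeffPer_zero hη hw) hA.pos.le
  linarith [hA.le_re_sesqForm ρ η w]

theorem IsBlochSystem.sum_norm_inner_mode_sq_le (hA : IsAdmissible α β A)
    (hB : IsBlochSystem A ρ lam φ) (hη : η ∈ dualCell d) (w : h2Per d) (N : ℕ) :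
    ∑ m ∈ Finset.Icc 1 N, ‖inner ℂ (h2PerToLp d (hB.mode hη m)) (h2PerToLp d w)‖ ^ 2 ≤
      4 / α * (|β| * d * ∑ j, ‖shiftedPartial η j w‖ ^ 2 +
        ρ ^ 2 * ‖shiftedLaplacian η w‖ ^ 2) := by
  set b : ℕ → ℝ := fun m => ‖inner ℂ (h2PerToLp d (hB.mode hη m)) (h2PerToLp d w)‖ ^ 2
  have hbound : α / 4 * ∑ m ∈ Finset.Icc 1 N, b m ≤ |β| * d * ∑ j, ‖shiftedPartial η j w‖ ^ 2 +
      ρ ^ 2 * ‖shiftedLaplacian η w‖ ^ 2 :=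
    calc α / 4 * ∑ m ∈ Finset.Icc 1 N, b m = ∑ m ∈ Finset.Icc 1 N, α / 4 * b m :=
          Finset.mul_sum _ _ _
      _ ≤ ∑ m ∈ Finset.Icc 1 N, lam m η * b m :=
          Finset.sum_le_sum fun m hm => mul_le_mul_of_nonneg_right
            (hB.le_eigenvalue hA hη (Finset.mem_Icc.mp hm).1) (by positivity)
      _ ≤ (hA.sesqForm ρ η w w).re :=
          sum_eigenvalue_mul_norm_inner_sq_le (fun u v => hA.shiftedForm_conj ρ η v u)
            (hA.sesqForm_nonneg ρ η) (hB.orthonormal_mode hη) (hB.sesqForm_mode hA hη) _ w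
      _ ≤ _ := hA.re_sesqForm_le ρ η w
  rw [div_mul_eq_mul_div, le_div_iff₀ hA.pos]
  linarith

end SpectralGap

/-! ### The Fourier transform -/

section AngularFourier

variable {d : ℕ}

/-- The Fourier transform `ζ ↦ ∫ u(x) e^{-i x · ζ} dx` of `u ∈ L²(ℝ^d)` in angular frequency;
the Fourier transform of Mathlib has the kernel `e^{-2π i x · ξ}`. -/
def angularFourier (u : L2 d) (ζ : E d) : ℂ := (𝓕 u : L2 d) ((2 * Real.pi)⁻¹ • ζ)

lemma two_pi_inv_ne_zero : (2 * Real.pi)⁻¹ ≠ 0 := by positivity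

lemma ae_two_pi_inv_smul {p : E d → Prop} (h : ∀ᵐ ξ, p ξ) :
    ∀ᵐ ζ : E d, p ((2 * Real.pi)⁻¹ • ζ) :=
  (Measure.quasiMeasurePreserving_smul volume two_pi_inv_ne_zero).ae h

lemma ae_eq_of_forall_schwartz {f g : E d → ℂ} (hf : LocallyIntegrable f)
    (hg : LocallyIntegrable g) (h : ∀ ψ : 𝓢(E d, ℂ), ∫ x, ψ x • f x = ∫ x, ψ x • g x) :
    f =ᵐ[volume] g := by
  refine ae_eq_of_integral_contDiff_smul_eq hf hg fun k hk hc => ?_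
  have hcompact : HasCompactSupport (Complex.ofRealCLM ∘ k) := hc.comp_left rfl
  have hsmooth : ContDiff ℝ (⊤ : ℕ∞) (Complex.ofRealCLM ∘ k) := by fun_prop
  simpa using h (hcompact.toSchwartzMap hsmooth)

lemma ae_eq_of_toTemperedDistribution_eq_smulLeftCLM {u g : L2 d} {p : E d → ℂ}
    (hp : p.HasTemperateGrowth) {a : ℂ}
    (h : (g : 𝓢'(E d, ℂ)) = a • TemperedDistribution.smulLeftCLM ℂ p (u : 𝓢'(E d, ℂ))) :
    g =ᵐ[volume] fun x => a * p x * u x := by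
  have hcont : Continuous fun x => a * p x := continuous_const.mul hp.1.continuous
  refine ae_eq_of_forall_schwartz ((Lp.memLp g).locallyIntegrable one_le_two)
    (((Lp.memLp u).locallyIntegrable one_le_two).continuous_smul hcont) fun ψ => ?_
  have hψ : ∫ x, ψ x • g x = a * ∫ x, SchwartzMap.smulLeftCLM ℂ p ψ x • u x := by
    have happly := congrArg (fun T : 𝓢'(E d, ℂ) => T ψ) h
    change _ = a * TemperedDistribution.smulLeftCLM ℂ p (u : 𝓢'(E d, ℂ)) ψ at happly
    simpa only [TemperedDistribution.smulLeftCLM_apply_apply, Lp.toTemperedDistribution_apply]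
      using happly
  rw [hψ, ← integral_const_mul]
  refine integral_congr_ae (Eventually.of_forall fun x => ?_)
  simp only [SchwartzMap.smulLeftCLM_apply_apply hp, smul_eq_mul]
  ring

lemma IsPartial.fourier_ae_eq {j : Fin d} {u g : L2 d} (h : IsPartial j u g) :
    (𝓕 g : L2 d) =ᵐ[volume] fun ξ => 2 * Real.pi * Complex.I * (ξ j : ℂ) * (𝓕 u : L2 d) ξ := by
  have hfourier : ((𝓕 g : L2 d) : 𝓢'(E d, ℂ)) = (2 * Real.pi * Complex.I) •
      TemperedDistribution.smulLeftCLM ℂ (inner ℝ · (EuclideanSpace.single j (1 : ℝ)))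
        ((𝓕 u : L2 d) : 𝓢'(E d, ℂ)) := by
    rw [← Lp.fourier_toTemperedDistribution_eq, ← Lp.fourier_toTemperedDistribution_eq,
      ← TemperedDistribution.fourier_lineDerivOp_eq, ← h]
  filter_upwards [ae_eq_of_toTemperedDistribution_eq_smulLeftCLM (by fun_prop) hfourier] with ξ hξ
  simpa [EuclideanSpace.inner_single_right] using hξ

lemma IsLaplacian.fourier_ae_eq {u g : L2 d} (h : IsLaplacian u g) :
    (𝓕 g : L2 d) =ᵐ[volume]
      fun ξ => ((-(2 * Real.pi) ^ 2 : ℝ) : ℂ) * ((‖ξ‖ ^ 2 : ℝ) : ℂ) * (𝓕 u : L2 d) ξ := by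
  refine ae_eq_of_toTemperedDistribution_eq_smulLeftCLM
    (p := fun ξ => Complex.ofReal (‖ξ‖ ^ 2)) (by fun_prop) ?_
  rw [← Lp.fourier_toTemperedDistribution_eq, ← Lp.fourier_toTemperedDistribution_eq, h,
    TemperedDistribution.laplacian_eq_fourierMultiplierCLM, ← Complex.coe_smul,
    FourierTransform.fourier_smul, TemperedDistribution.fourierMultiplierCLM_apply,
    FourierTransform.fourier_fourierInv_eq]

theorem IsPartial.angularFourier_ae_eq {j : Fin d} {u g : L2 d} (h : IsPartial j u g) :
    ∀ᵐ ζ, angularFourier g ζ = Complex.I * (ζ j : ℂ) * angularFourier u ζ := by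
  filter_upwards [ae_two_pi_inv_smul h.fourier_ae_eq] with ζ hζ
  have hpi : (Real.pi : ℂ) ≠ 0 := by exact_mod_cast Real.pi_ne_zero
  simp only [angularFourier, hζ, PiLp.smul_apply, smul_eq_mul]
  push_cast
  field_simp

theorem IsLaplacian.angularFourier_ae_eq {u g : L2 d} (h : IsLaplacian u g) :
    ∀ᵐ ζ : E d, angularFourier g ζ = -((∑ j, ζ j ^ 2 : ℝ) : ℂ) * angularFourier u ζ := by
  filter_upwards [ae_two_pi_inv_smul h.fourier_ae_eq] with ζ hζ
  have hnorm : -(2 * Real.pi) ^ 2 * ‖(2 * Real.pi)⁻¹ • ζ‖ ^ 2 = -∑ j, ζ j ^ 2 := by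
    rw [norm_smul, mul_pow ‖_‖, EuclideanSpace.real_norm_sq_eq, Real.norm_eq_abs, sq_abs,
      neg_mul, ← mul_assoc, ← mul_pow, mul_inv_cancel₀ Real.two_pi_pos.ne', one_pow, one_mul]
  rw [angularFourier, hζ, ← Complex.ofReal_mul, hnorm, Complex.ofReal_neg]
  rfl

lemma aestronglyMeasurable_angularFourier (u : L2 d) :
    AEStronglyMeasurable (angularFourier u) volume :=
  (Lp.memLp (𝓕 u : L2 d)).1.comp_quasiMeasurePreserving
    (Measure.quasiMeasurePreserving_smul volume two_pi_inv_ne_zero)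

lemma lintegral_enorm_sq_Lp {X : Type*} [MeasurableSpace X] {μ : Measure X} (u : Lp ℂ 2 μ) :
    ∫⁻ x, ‖u x‖ₑ ^ 2 ∂μ = ENNReal.ofReal (‖u‖ ^ 2) := by
  rw [norm_Lp_sq, ofReal_integral_eq_lintegral_ofReal (integrable_norm_Lp_sq u)
    (Eventually.of_forall fun x => by positivity)]
  simp only [ENNReal.ofReal_pow (norm_nonneg _), ofReal_norm]

theorem lintegral_enorm_angularFourier_sq (u : L2 d) :
    ∫⁻ ζ, ‖angularFourier u ζ‖ₑ ^ 2 = ENNReal.ofReal (cellVol d * ‖u‖ ^ 2) := by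
  have hmeas : AEMeasurable (fun ξ => ‖(𝓕 u : L2 d) ξ‖ₑ ^ 2)
      (Measure.map (fun ζ : E d => (2 * Real.pi)⁻¹ • ζ) volume) := by
    rw [Measure.map_addHaar_smul _ two_pi_inv_ne_zero]
    exact ((Lp.aestronglyMeasurable (𝓕 u : L2 d)).enorm.pow_const 2).smul_measure _
  calc ∫⁻ ζ, ‖angularFourier u ζ‖ₑ ^ 2
      = ∫⁻ ξ, ‖(𝓕 u : L2 d) ξ‖ₑ ^ 2
          ∂(Measure.map (fun ζ : E d => (2 * Real.pi)⁻¹ • ζ) volume) :=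
        (lintegral_map' hmeas (by fun_prop)).symm
    _ = ENNReal.ofReal (cellVol d * ‖u‖ ^ 2) := by
        rw [Measure.map_addHaar_smul _ two_pi_inv_ne_zero, lintegral_smul_measure,
          lintegral_enorm_sq_Lp, Lp.norm_fourier_eq, smul_eq_mul,
          ← ENNReal.ofReal_mul (abs_nonneg _), finrank_euclideanSpace_fin, inv_pow, inv_inv,
          abs_of_pos (by positivity), cellVol]

lemma fourier_toLp_ae_eq {h : E d → ℂ} (hint : Integrable h) (hL2 : MemLp h 2) :
    (𝓕 (hL2.toLp h) : L2 d) =ᵐ[volume] 𝓕 h := by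
  have hcont : Continuous (𝓕 h) :=
    VectorFourier.fourierIntegral_continuous Real.continuous_fourierChar continuous_inner hint
  refine ae_eq_of_forall_schwartz ((Lp.memLp _).locallyIntegrable one_le_two)
    hcont.locallyIntegrable fun ψ => ?_
  have hdistrib : ∫ x, ψ x • (𝓕 (hL2.toLp h) : L2 d) x = ∫ x, (𝓕 ψ) x • hL2.toLp h x := by
    simpa only [Lp.toTemperedDistribution_apply, TemperedDistribution.fourier_apply] using
      (congrArg (fun T : 𝓢'(E d, ℂ) => T ψ)
        (Lp.fourier_toTemperedDistribution_eq (hL2.toLp h))).symm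
  have hflip := VectorFourier.integral_fourierIntegral_smul_eq_flip (L := innerₗ (E d))
    (μ := volume) (ν := volume) Real.continuous_fourierChar continuous_inner ψ.integrable hint
  rw [flip_innerₗ] at hflip
  rw [hdistrib]
  refine Eq.trans (integral_congr_ae ?_) hflip
  filter_upwards [hL2.coeFn_toLp] with x hx
  rw [hx]
  rfl

theorem angularFourier_toLp_ae_eq {h : E d → ℂ} (hint : Integrable h) (hL2 : MemLp h 2) :
    ∀ᵐ ζ, angularFourier (hL2.toLp h) ζ = ∫ x, h x * conj (planeWave x ζ) := by
  filter_upwards [ae_two_pi_inv_smul (fourier_toLp_ae_eq hint hL2)] with ζ hζ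
  rw [angularFourier, hζ, Real.fourier_eq']
  refine integral_congr_ae (Eventually.of_forall fun x => ?_)
  have hphase : -2 * Real.pi * inner ℝ x ((2 * Real.pi)⁻¹ • ζ) = -∑ j, x j * ζ j := by
    rw [inner_smul_right, PiLp.inner_apply]
    simp only [RCLike.inner_apply, conj_trivial, mul_comm (ζ _)]
    field_simp
  simp only [hphase, smul_eq_mul, planeWave, ← Complex.exp_conj, map_mul, Complex.conj_I,
    Complex.conj_ofReal, mul_comm (h x)]
  push_cast
  ring_nf

lemma angularFourier_add (u v : L2 d) :
    ∀ᵐ ζ, angularFourier (u + v) ζ = angularFourier u ζ + angularFourier v ζ := by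
  have hadd : (𝓕 (u + v) : L2 d) = 𝓕 u + 𝓕 v := (Lp.fourierTransformₗᵢ (E d) ℂ).map_add u v
  simp only [angularFourier, hadd]
  exact ae_two_pi_inv_smul (Lp.coeFn_add _ _)

lemma angularFourier_smul (a : ℂ) (u : L2 d) :
    ∀ᵐ ζ, angularFourier (a • u) ζ = a * angularFourier u ζ := by
  have hsmul : (𝓕 (a • u) : L2 d) = a • 𝓕 u := (Lp.fourierTransformₗᵢ (E d) ℂ).map_smul a u
  simp only [angularFourier, hsmul]
  exact ae_two_pi_inv_smul (Lp.coeFn_smul _ _)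

end AngularFourier

/-! ### The Floquet fibers of a function -/

section DualLattice

variable {d : ℕ} {ε : ℝ}

/-- The point `n / ε` of the rescaled dual lattice. -/
def latticePoint (ε : ℝ) (n : Fin d → ℤ) : E d := WithLp.toLp 2 fun j => ε⁻¹ * (n j : ℝ)

lemma measurableSet_dualCell (d : ℕ) : MeasurableSet (dualCell d) := by
  have hpi : dualCell d = ⋂ i, (fun y : E d => y i) ⁻¹' Set.Ico (-(1 / 2) : ℝ) (1 / 2) := by
    ext; simp [dualCell]
  rw [hpi]
  exact MeasurableSet.iInter fun i => (by fun_prop : Measurable fun y : E d => y i)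
    measurableSet_Ico

lemma measurableSet_scaledDualCell (d : ℕ) (ε : ℝ) : MeasurableSet (scaledDualCell d ε) :=
  (by fun_prop : Measurable fun ξ : E d => ε • ξ) (measurableSet_dualCell d)

lemma sub_latticePoint_mem_scaledDualCell_iff (hε : 0 < ε) (n : Fin d → ℤ) (ζ : E d) :
    ζ - latticePoint ε n ∈ scaledDualCell d ε ↔ n = fun j => ⌊ε * ζ j + 1 / 2⌋ := by
  simp only [scaledDualCell, dualCell, Set.mem_ofPred_eq, Set.mem_Ico, funext_iff]
  refine forall_congr' fun j => ?_
  rw [eq_comm, Int.floor_eq_iff]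
  simp only [PiLp.smul_apply, PiLp.sub_apply, latticePoint, smul_eq_mul, mul_sub,
    mul_inv_cancel_left₀ hε.ne']
  constructor <;> rintro ⟨hlower, hupper⟩ <;> constructor <;> linarith

theorem lintegral_eq_tsum_scaledDualCell (hε : 0 < ε) (f : E d → ℝ≥0∞) :
    ∫⁻ ζ, f ζ = ∑' n, ∫⁻ ξ in scaledDualCell d ε, f (ξ + latticePoint ε n) := by
  let S : (Fin d → ℤ) → Set (E d) :=
    fun n => (fun ζ => ζ - latticePoint ε n) ⁻¹' scaledDualCell d ε
  have mem_S : ∀ n ζ, ζ ∈ S n ↔ n = fun j => ⌊ε * ζ j + 1 / 2⌋ :=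
    sub_latticePoint_mem_scaledDualCell_iff hε
  have hmeas : ∀ n, MeasurableSet (S n) := fun n =>
    (by fun_prop : Measurable fun ζ => ζ - latticePoint ε n) (measurableSet_scaledDualCell d ε)
  have hdisjoint : Pairwise (Function.onFun Disjoint S) := fun m n hmn =>
    Set.disjoint_left.mpr fun ζ hm hn =>
      hmn (((mem_S m ζ).mp hm).trans ((mem_S n ζ).mp hn).symm)
  have hcover : ⋃ n, S n = Set.univ :=
    Set.eq_univ_of_forall fun ζ => Set.mem_iUnion.mpr ⟨_, (mem_S _ ζ).mpr rfl⟩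
  rw [← setLIntegral_univ, ← hcover, lintegral_iUnion hmeas hdisjoint]
  refine tsum_congr fun n => ?_
  have hpreserving := (measurePreserving_sub_right volume (latticePoint ε n)).restrict_preimage
    (measurableSet_scaledDualCell d ε)
  rw [← hpreserving.lintegral_comp_emb
    (MeasurableEquiv.subRight (latticePoint ε n)).measurableEmbedding]
  simp only [sub_add_cancel, S]

end DualLattice

section CellFract

variable {d : ℕ}

/-- The representative of `y` modulo `2πℤ^d` in the cell. -/
def cellFract (y : E d) : E d := WithLp.toLp 2 fun j => toIcoMod Real.two_pi_pos 0 (y j)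

lemma cellFract_eq_add (y : E d) :
    cellFract y =
      y + WithLp.toLp 2 fun j => 2 * Real.pi * ((-⌊y j / (2 * Real.pi)⌋ : ℤ) : ℝ) := by
  ext j
  simp only [cellFract, PiLp.add_apply, ← self_sub_toIcoDiv_zsmul, toIcoDiv_eq_floor, sub_zero]
  rw [zsmul_eq_mul]
  push_cast
  ring

lemma measurable_cellFract (d : ℕ) : Measurable (cellFract : E d → E d) := by
  simp only [funext cellFract_eq_add]
  refine measurable_id.add
    ((WithLp.measurable_toLp 2 (Fin d → ℝ)).comp (measurable_pi_lambda _ fun j => ?_))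
  exact (measurable_of_countable fun z : ℤ => 2 * Real.pi * ((-z : ℤ) : ℝ)).comp
    (Int.measurable_floor.comp (by fun_prop))

lemma cellFract_mem (y : E d) : cellFract y ∈ cell d := fun _ => toIcoMod_mem_Ico' _ _

lemma cellFract_eq_of_mem {y : E d} (h : y ∈ cell d) : cellFract y = y := by
  ext j
  refine (toIcoMod_eq_self Real.two_pi_pos).mpr ?_
  rw [zero_add]
  exact h j

lemma cellFract_add (y : E d) (p : Fin d → ℤ) :
    cellFract (y + WithLp.toLp 2 fun j => 2 * Real.pi * (p j : ℝ)) = cellFract y := by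
  ext j
  have hzsmul : 2 * Real.pi * (p j : ℝ) = p j • (2 * Real.pi) := by rw [zsmul_eq_mul, mul_comm]
  simp only [cellFract, PiLp.add_apply, hzsmul, toIcoMod_add_zsmul]

lemma expMode_cellFract (n : Fin d → ℤ) (y : E d) : expMode n (cellFract y) = expMode n y := by
  rw [cellFract_eq_add, expMode, expMode, Complex.exp_eq_exp_iff_exists_int]
  refine ⟨-∑ j, n j * ⌊y j / (2 * Real.pi)⌋, ?_⟩
  simp only [PiLp.add_apply, mul_add, Finset.sum_add_distrib]
  push_cast
  rw [mul_add, Finset.mul_sum, Finset.mul_sum, neg_mul, Finset.sum_mul, ← Finset.sum_neg_distrib]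
  congr 1
  exact Finset.sum_congr rfl fun j _ => by ring

lemma ae_cellFract_eq {u : E d → ℂ}
    (hu : ∀ p : Fin d → ℤ, ∀ᵐ y, u (y + WithLp.toLp 2 (fun j => 2 * Real.pi * (p j : ℝ))) = u y) :
    ∀ᵐ y, u (cellFract y) = u y := by
  filter_upwards [ae_all_iff.mpr hu] with y hy
  rw [cellFract_eq_add]
  exact hy fun j => -⌊y j / (2 * Real.pi)⌋

lemma comp_cellFract_ae_eq (w : E d → ℂ) : (fun y => w (cellFract y)) =ᵐ[cellMeasure d] w := by
  filter_upwards [ae_restrict_mem (measurableSet_cell d)] with y hy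
  rw [cellFract_eq_of_mem hy]

theorem memH2Per_comp_cellFract {w : E d → ℂ} (hw : MemLp w 2 (cellMeasure d))
    (hsum : Summable fun n : Fin d → ℤ =>
      (1 + ∑ j, (n j : ℝ) ^ 2) ^ 2 * ‖fourierCoeffPer w n‖ ^ 2) :
    MemH2Per fun y => w (cellFract y) := by
  have hae := comp_cellFract_ae_eq w
  refine ⟨fun p => Eventually.of_forall fun y => ?_, (memLp_congr_ae hae).mpr hw, ?_⟩
  · simp only [cellFract_add]
  · simpa only [fourierCoeffPer_congr hae] using hsum

/-- A finite set containing the indices of all the translates of the cell by `2πℤ^d` that meet the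
ball of radius `r` about the origin. -/
def cellIndices (d : ℕ) (r : ℝ) : Finset (Fin d → ℤ) :=
  Fintype.piFinset fun _ => Finset.Icc (-(⌈|r|⌉ + 1)) (⌈|r|⌉ + 1)

lemma floor_div_two_pi_mem_cellIndices {r : ℝ} {y : E d} (hy : y ∈ Metric.ball 0 r) :
    (fun j => ⌊y j / (2 * Real.pi)⌋) ∈ cellIndices d r := by
  refine Fintype.mem_piFinset.mpr fun j => ?_
  have hcoord : |y j| < r := (PiLp.norm_apply_le y j).trans_lt (mem_ball_zero_iff.mp hy)
  have hdiv : |y j / (2 * Real.pi)| ≤ |r| := by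
    rw [abs_div, abs_of_pos Real.two_pi_pos]
    exact (div_le_self (abs_nonneg _) (by linarith [Real.pi_gt_three])).trans
      (hcoord.le.trans (le_abs_self r))
  obtain ⟨hlower, hupper⟩ := abs_le.mp (hdiv.trans (Int.le_ceil |r|))
  rw [Finset.mem_Icc, Int.le_floor, Int.floor_le_iff]
  push_cast
  constructor <;> linarith

theorem volume_ball_inter_cellFract_le (r : ℝ) {s : Set (E d)} (hs : MeasurableSet s) :
    volume (Metric.ball 0 r ∩ cellFract ⁻¹' s) ≤ (cellIndices d r).card * cellMeasure d s := by
  let translate : (Fin d → ℤ) → E d → E d :=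
    fun p y => y + WithLp.toLp 2 (fun j => 2 * Real.pi * ((-p j : ℤ) : ℝ))
  have hcover : Metric.ball 0 r ∩ cellFract ⁻¹' s ⊆
      ⋃ p ∈ cellIndices d r, translate p ⁻¹' (s ∩ cell d) := by
    rintro y ⟨hy, hys⟩
    have hmem : cellFract y ∈ s ∩ cell d := ⟨hys, cellFract_mem y⟩
    rw [cellFract_eq_add] at hmem
    exact Set.mem_biUnion (floor_div_two_pi_mem_cellIndices hy) hmem
  have hvolume : ∀ p, volume (translate p ⁻¹' (s ∩ cell d)) = cellMeasure d s := fun p => by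
    rw [cellMeasure, Measure.restrict_apply hs]
    exact (measurePreserving_add_right volume _).measure_preimage
      (hs.inter (measurableSet_cell d)).nullMeasurableSet
  calc volume (Metric.ball 0 r ∩ cellFract ⁻¹' s)
      ≤ ∑ p ∈ cellIndices d r, volume (translate p ⁻¹' (s ∩ cell d)) :=
        (measure_mono hcover).trans (measure_biUnion_finset_le _ _)
    _ = (cellIndices d r).card * cellMeasure d s := by
        simp only [hvolume, Finset.sum_const, nsmul_eq_mul]

end CellFract

section Pullback

variable {X Y : Type*} [MeasurableSpace X] [MeasurableSpace Y] {μ : Measure X} {ν : Measure Y}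
  {T : X → Y} {C : ℝ≥0∞}

lemma quasiMeasurePreserving_of_map_le (hT : Measurable T) (hle : Measure.map T μ ≤ C • ν) :
    Measure.QuasiMeasurePreserving T μ ν :=
  ⟨hT, (Measure.absolutelyContinuous_of_le hle).trans Measure.smul_absolutelyContinuous⟩

lemma eLpNorm_comp_le_of_map_le (hT : Measurable T) (hle : Measure.map T μ ≤ C • ν) {w : Y → ℂ}
    (hw : AEStronglyMeasurable w ν) :
    eLpNorm (w ∘ T) 2 μ ≤ C ^ (1 / 2 : ℝ) * eLpNorm w 2 ν := by
  rw [← eLpNorm_map_measure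
    (hw.mono_ac (quasiMeasurePreserving_of_map_le hT hle).absolutelyContinuous) hT.aemeasurable]
  refine (eLpNorm_mono_measure w hle).trans_eq ?_
  rw [eLpNorm_smul_measure_of_ne_top ENNReal.ofNat_ne_top]
  simp

lemma memLp_comp_of_map_le (hT : Measurable T) (hC : C ≠ ⊤) (hle : Measure.map T μ ≤ C • ν)
    {w : Y → ℂ} (hw : MemLp w 2 ν) : MemLp (w ∘ T) 2 μ :=
  (hw.smul_measure hC).mono_measure hle |>.comp_of_map hT.aemeasurable

/-- Composition with `T` as a bounded map from `L²(ν)` to `L²(μ)`, when the image of `μ` under `T`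
is at most `C • ν`. -/
def pullbackLp (hT : Measurable T) (hC : C ≠ ⊤) (hle : Measure.map T μ ≤ C • ν) :
    Lp ℂ 2 ν →L[ℂ] Lp ℂ 2 μ :=
  LinearMap.mkContinuous
    { toFun := fun w => (memLp_comp_of_map_le hT hC hle (Lp.memLp w)).toLp _
      map_add' := fun v w => by
        rw [← MemLp.toLp_add]
        exact MemLp.toLp_congr _ _
          ((quasiMeasurePreserving_of_map_le hT hle).ae (Lp.coeFn_add v w))
      map_smul' := fun a w => by
        rw [RingHom.id_apply, ← MemLp.toLp_const_smul]
        exact MemLp.toLp_congr _ _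
          ((quasiMeasurePreserving_of_map_le hT hle).ae (Lp.coeFn_smul a w)) }
    (C ^ (1 / 2 : ℝ)).toReal
    (fun w => by
      change ‖(memLp_comp_of_map_le hT hC hle (Lp.memLp w)).toLp _‖ ≤ _
      rw [Lp.norm_toLp, Lp.norm_def, ← ENNReal.toReal_mul]
      exact ENNReal.toReal_mono (ENNReal.mul_ne_top
        (ENNReal.rpow_ne_top_of_nonneg (by norm_num) hC) (Lp.memLp w).2.ne)
        (eLpNorm_comp_le_of_map_le hT hle (Lp.memLp w).1))

lemma coeFn_pullbackLp_toLp (hT : Measurable T) (hC : C ≠ ⊤) (hle : Measure.map T μ ≤ C • ν)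
    {w : Y → ℂ} (hw : MemLp w 2 ν) : pullbackLp hT hC hle (hw.toLp w) =ᵐ[μ] w ∘ T :=
  (MemLp.coeFn_toLp (memLp_comp_of_map_le hT hC hle (Lp.memLp (hw.toLp w)))).trans
    ((quasiMeasurePreserving_of_map_le hT hle).ae hw.coeFn_toLp)

end Pullback

section Balls

variable {d : ℕ} {ε : ℝ}

/-- A bound for the density, with respect to Lebesgue measure on the cell, of the image of Lebesgue
measure on the ball of radius `R` under `x ↦ x / ε` modulo `2πℤ^d`. -/
def ballConst (d : ℕ) (ε R : ℝ) : ℝ≥0∞ :=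
  ENNReal.ofReal |ε ^ d| * (cellIndices d (ε⁻¹ * R)).card

lemma ballConst_ne_top (d : ℕ) (ε R : ℝ) : ballConst d ε R ≠ ⊤ := by
  unfold ballConst
  finiteness

lemma measurable_cellFract_smul (d : ℕ) (ε : ℝ) :
    Measurable fun x : E d => cellFract (ε⁻¹ • x) :=
  (measurable_cellFract d).comp (by fun_prop)

open scoped Pointwise in
theorem map_cellFract_smul_le (d : ℕ) (hε : 0 < ε) (R : ℝ) :
    Measure.map (fun x : E d => cellFract (ε⁻¹ • x)) (volume.restrict (Metric.ball 0 R)) ≤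
      ballConst d ε R • cellMeasure d := by
  refine Measure.le_iff.mpr fun s hs => ?_
  have hpreimage : (fun x : E d => cellFract (ε⁻¹ • x)) ⁻¹' s ∩ Metric.ball 0 R =
      ε • (Metric.ball 0 (ε⁻¹ * R) ∩ cellFract ⁻¹' s) := by
    ext x
    rw [Set.mem_smul_set_iff_inv_smul_mem₀ hε.ne']
    simp only [Set.mem_inter_iff, Set.mem_preimage, mem_ball_zero_iff, norm_smul]
    rw [and_comm, norm_inv, Real.norm_eq_abs, abs_of_pos hε,
      mul_lt_mul_iff_right₀ (inv_pos.mpr hε)]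
  have hmeas := measurable_cellFract_smul d ε
  rw [Measure.map_apply hmeas hs, Measure.restrict_apply (hmeas hs), Measure.smul_apply,
    smul_eq_mul, hpreimage, Measure.addHaar_smul, finrank_euclideanSpace_fin, ballConst, mul_assoc]
  gcongr
  exact volume_ball_inter_cellFract_le _ hs

/-- Periodic extension, rescaling and restriction to a ball, as a bounded map. -/
def extendToBall (hε : 0 < ε) (R : ℝ) :
    Lp ℂ 2 (cellMeasure d) →L[ℂ] Lp ℂ 2 (volume.restrict (Metric.ball (0 : E d) R)) :=
  pullbackLp (measurable_cellFract_smul d ε) (ballConst_ne_top d ε R) (map_cellFract_smul_le d hε R)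

lemma MemH2Per.ae_cellFract_smul_eq {u : E d → ℂ} (hu : MemH2Per u) (hε : 0 < ε) :
    ∀ᵐ x : E d, u (cellFract (ε⁻¹ • x)) = u (ε⁻¹ • x) :=
  (Measure.quasiMeasurePreserving_smul volume (inv_ne_zero hε.ne')).ae (ae_cellFract_eq hu.periodic)

lemma planeWave_mul_expMode (ε : ℝ) (n : Fin d → ℤ) (x ξ : E d) :
    planeWave x ξ * expMode n (ε⁻¹ • x) = planeWave x (ξ + latticePoint ε n) := by
  unfold planeWave expMode
  rw [← Complex.exp_add, ← mul_add, ← Complex.ofReal_add, ← Finset.sum_add_distrib]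
  refine congrArg (fun r : ℝ => Complex.exp (Complex.I * r))
    (Finset.sum_congr rfl fun j _ => ?_)
  simp only [PiLp.smul_apply, PiLp.add_apply, latticePoint, smul_eq_mul]
  ring

lemma norm_planeWave (x ξ : E d) : ‖planeWave x ξ‖ = 1 := by
  rw [planeWave, mul_comm, Complex.norm_exp_ofReal_mul_I]

lemma continuous_planeWave : Continuous fun z : E d × E d => planeWave z.1 z.2 := by
  unfold planeWave
  fun_prop

lemma memLp_mul_conj_planeWave {μ : Measure (E d)} {h : E d → ℂ} (hh : MemLp h 2 μ) (ξ : E d) :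
    MemLp (fun x => h x * conj (planeWave x ξ)) 2 μ := by
  have hcont : Continuous fun x : E d => conj (planeWave x ξ) :=
    Complex.continuous_conj.comp (continuous_planeWave.comp (by fun_prop : Continuous
      fun x : E d => (x, ξ)))
  refine hh.of_le (hh.1.mul hcont.aestronglyMeasurable) (Eventually.of_forall fun x => ?_)
  rw [norm_mul, RCLike.norm_conj, norm_planeWave, mul_one]

theorem hasSum_integral_ball_mul_conj (hε : 0 < ε) {R : ℝ} {h : E d → ℂ}
    (hh : MemLp h 2 (volume.restrict (Metric.ball 0 R))) {ψ : E d → ℂ} (hψ : MemH2Per ψ)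
    (ξ : E d) :
    HasSum (fun n => (∫ x in Metric.ball 0 R, h x * conj (planeWave x (ξ + latticePoint ε n))) *
        conj (fourierCoeffPer ψ n))
      (∫ x in Metric.ball 0 R, h x * conj (planeWave x ξ) * conj (ψ (ε⁻¹ • x))) := by
  have hwave := memLp_mul_conj_planeWave hh ξ
  have coeFn_extendToBall {w : E d → ℂ} (hw : MemLp w 2 (cellMeasure d)) :=
    coeFn_pullbackLp_toLp (measurable_cellFract_smul d ε) (ballConst_ne_top d ε R)
      (map_cellFract_smul_le d hε R) hw
  have hinner := (((hasSum_fourierCoeffPer hψ.memLp).mapL (extendToBall hε R)).mapL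
    (innerSL ℂ (hwave.toLp _))).mapL (Complex.conjCLE : ℂ →L[ℝ] ℂ)
  simp only [map_smul, innerSL_apply_apply, smul_eq_mul, ContinuousLinearEquiv.coe_coe,
    Complex.conjCLE_apply, map_mul, inner_conj_symm] at hinner
  simp only [L2.inner_def] at hinner
  convert! hinner using 1
  · ext n
    rw [mul_comm]
    congr 1
    refine integral_congr_ae ?_
    filter_upwards [hwave.coeFn_toLp, coeFn_extendToBall (memLp_expMode n)] with x hx hmode
    change _ = inner ℂ (extendToBall hε R (MemLp.toLp (expMode n) (memLp_expMode n)) x) _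
    rw [hx, extendToBall, hmode, Function.comp_apply, expMode_cellFract, RCLike.inner_apply,
      ← planeWave_mul_expMode ε, map_mul]
    ring
  · refine integral_congr_ae ?_
    filter_upwards [hwave.coeFn_toLp, coeFn_extendToBall hψ.memLp,
      ae_restrict_of_ae (hψ.ae_cellFract_smul_eq hε)] with x hx hpull hper
    rw [hx, extendToBall, hpull, Function.comp_apply, hper, RCLike.inner_apply]

end Balls

/-! ### The Bloch transform -/

section SquareNorms

lemma eLpNorm_two_sq {X F : Type*} [MeasurableSpace X] {μ : Measure X} [NormedAddCommGroup F]
    (f : X → F) : eLpNorm f 2 μ ^ 2 = ∫⁻ x, ‖f x‖ₑ ^ 2 ∂μ := by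
  rw [eLpNorm_eq_lintegral_rpow_enorm_toReal two_ne_zero ENNReal.ofNat_ne_top,
    ← ENNReal.rpow_natCast, ← ENNReal.rpow_mul]
  simp

lemma enorm_sq_eq_ofReal {F : Type*} [SeminormedAddCommGroup F] (x : F) :
    ‖x‖ₑ ^ 2 = ENNReal.ofReal (‖x‖ ^ 2) := by
  rw [ENNReal.ofReal_pow (norm_nonneg x), ofReal_norm]

lemma summable_norm_sq_of_tsum_enorm_ne_top {ι F : Type*} [SeminormedAddCommGroup F] {c : ι → F}
    (h : ∑' n, ‖c n‖ₑ ^ 2 ≠ ⊤) : Summable fun n => ‖c n‖ ^ 2 := by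
  simpa using ENNReal.summable_toReal h

lemma summable_const_mul_norm_sq {ι 𝕜 : Type*} [NormedDivisionRing 𝕜] (a : 𝕜) {c : ι → 𝕜}
    (hc : Summable fun n => ‖c n‖ ^ 2) : Summable fun n => ‖a * c n‖ ^ 2 := by
  simpa only [norm_mul, mul_pow] using hc.mul_left (‖a‖ ^ 2)

lemma enorm_fourierSeries_sq {d : ℕ} {c : (Fin d → ℤ) → ℂ} (hc : Summable fun n => ‖c n‖ ^ 2) :
    ‖fourierSeries c‖ₑ ^ 2 = ENNReal.ofReal (cellVol d) * ∑' n, ‖c n‖ₑ ^ 2 := by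
  rw [enorm_sq_eq_ofReal, ← (hasSum_norm_fourierSeries_sq hc).tsum_eq, tsum_mul_left,
    ENNReal.ofReal_mul (cellVol_pos d).le,
    ENNReal.ofReal_tsum_of_nonneg (fun n => by positivity) hc]
  simp only [enorm_sq_eq_ofReal]

lemma tendsto_setLIntegral_compl_ball {X : Type*} [PseudoMetricSpace X] [MeasurableSpace X]
    [OpensMeasurableSpace X] {μ : Measure X} {f : X → ℝ≥0∞} (hf : AEMeasurable f μ)
    (hfin : ∫⁻ x, f x ∂μ ≠ ⊤) (x₀ : X) :
    Tendsto (fun R => ∫⁻ x in (Metric.ball x₀ R)ᶜ, f x ∂μ) atTop (𝓝 0) := by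
  have hball :=
    (aecover_ball (μ := μ) (x := x₀) tendsto_id).lintegral_tendsto_of_countably_generated hf
  have hsub := ENNReal.Tendsto.sub tendsto_const_nhds hball (Or.inl hfin)
  rw [tsub_self] at hsub
  refine hsub.congr fun R => ?_
  exact (setLIntegral_compl measurableSet_ball
    ((setLIntegral_le_lintegral _ _).trans_lt hfin.lt_top).ne).symm

end SquareNorms

lemma isFiniteMeasure_ball (d : ℕ) (R : ℝ) :
    IsFiniteMeasure ((volume : Measure (E d)).restrict (Metric.ball 0 R)) :=
  ⟨by simpa using measure_ball_lt_top⟩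

section Fiber

variable {d : ℕ} {ε : ℝ}

/-- Lebesgue measure on the scaled dual cell `ε⁻¹ Y'`. -/
abbrev dualMeasure (d : ℕ) (ε : ℝ) : Measure (E d) := volume.restrict (scaledDualCell d ε)

/-- The fiber at `ξ` of the Bloch decomposition of `u`: the periodic function with Fourier
coefficients `(2π)^{-d} û(ξ + n / ε)`. -/
def fiber (ε : ℝ) (u : L2 d) (ξ : E d) : Lp ℂ 2 (cellMeasure d) :=
  fourierSeries fun n => (cellVol d : ℂ)⁻¹ * angularFourier u (ξ + latticePoint ε n)

/-- The Bloch coefficient of `u` for the mode `φ`, as the `L²(Y)` inner product of the fiber of `u`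
with the mode; `IsBlochSystem.isBlochCoeff_transform` relates it to integrals over `ℝ^d`. -/
def blochCoeff (ε : ℝ) (φ : E d → E d → ℂ) (u : L2 d) (ξ : E d) : ℂ :=
  ∫ y in cell d, fiber ε u ξ y * conj (φ y (ε • ξ))

lemma ae_mem_scaledDualCell (d : ℕ) (ε : ℝ) :
    ∀ᵐ ξ ∂dualMeasure d ε, ε • ξ ∈ dualCell d :=
  ae_restrict_mem (measurableSet_scaledDualCell d ε)

lemma quasiMeasurePreserving_add_latticePoint (ε : ℝ) (n : Fin d → ℤ) :
    Measure.QuasiMeasurePreserving (fun ξ : E d => ξ + latticePoint ε n)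
      (dualMeasure d ε) volume :=
  (measurePreserving_add_right volume _).quasiMeasurePreserving.mono_left
    Measure.restrict_le_self.absolutelyContinuous

lemma ae_forall_add_latticePoint {p : E d → Prop} (ε : ℝ) (h : ∀ᵐ ζ, p ζ) :
    ∀ᵐ ξ ∂dualMeasure d ε, ∀ n : Fin d → ℤ, p (ξ + latticePoint ε n) :=
  ae_all_iff.mpr fun n => (quasiMeasurePreserving_add_latticePoint ε n).ae h

lemma aestronglyMeasurable_angularFourier_add (ε : ℝ) (u : L2 d) (n : Fin d → ℤ) :
    AEStronglyMeasurable (fun ξ => angularFourier u (ξ + latticePoint ε n))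
      (dualMeasure d ε) :=
  (aestronglyMeasurable_angularFourier u).comp_quasiMeasurePreserving
    (quasiMeasurePreserving_add_latticePoint ε n)

lemma aemeasurable_tsum_angularFourier (ε : ℝ) (u : L2 d) :
    AEMeasurable (fun ξ => ∑' n, ‖angularFourier u (ξ + latticePoint ε n)‖ₑ ^ 2)
      (dualMeasure d ε) :=
  AEMeasurable.tsum fun n =>
    (aestronglyMeasurable_angularFourier_add ε u n).enorm.pow_const 2

lemma lintegral_tsum_angularFourier (hε : 0 < ε) (u : L2 d) :
    ∫⁻ ξ, ∑' n, ‖angularFourier u (ξ + latticePoint ε n)‖ₑ ^ 2 ∂dualMeasure d ε =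
      ENNReal.ofReal (cellVol d * ‖u‖ ^ 2) := by
  rw [lintegral_tsum fun n =>
    (aestronglyMeasurable_angularFourier_add ε u n).enorm.pow_const 2,
    ← lintegral_enorm_angularFourier_sq, lintegral_eq_tsum_scaledDualCell hε]

lemma ae_summable_angularFourier (hε : 0 < ε) (u : L2 d) :
    ∀ᵐ ξ ∂dualMeasure d ε,
      Summable fun n => ‖angularFourier u (ξ + latticePoint ε n)‖ ^ 2 := by
  have hfinite := ae_lt_top' (aemeasurable_tsum_angularFourier ε u)
    (by rw [lintegral_tsum_angularFourier hε]; exact ENNReal.ofReal_ne_top)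
  filter_upwards [hfinite] with ξ hξ
  exact summable_norm_sq_of_tsum_enorm_ne_top hξ.ne

lemma enorm_fiber_sq {u : L2 d} {ξ : E d}
    (h : Summable fun n => ‖angularFourier u (ξ + latticePoint ε n)‖ ^ 2) :
    ‖fiber ε u ξ‖ₑ ^ 2 = ENNReal.ofReal (cellVol d)⁻¹ *
      ∑' n, ‖angularFourier u (ξ + latticePoint ε n)‖ₑ ^ 2 := by
  have hpos := cellVol_pos d
  rw [fiber, enorm_fourierSeries_sq (summable_const_mul_norm_sq _ h)]
  simp only [enorm_mul, mul_pow]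
  rw [ENNReal.tsum_mul_left, ← mul_assoc]
  congr 1
  rw [enorm_sq_eq_ofReal, ← ENNReal.ofReal_mul hpos.le, norm_inv, Complex.norm_real,
    Real.norm_eq_abs, abs_of_pos hpos]
  congr 1
  field_simp

lemma aemeasurable_enorm_fiber_sq (hε : 0 < ε) (u : L2 d) :
    AEMeasurable (fun ξ => ‖fiber ε u ξ‖ₑ ^ 2) (dualMeasure d ε) := by
  refine ((aemeasurable_tsum_angularFourier ε u).const_mul
    (ENNReal.ofReal (cellVol d)⁻¹)).congr ?_
  filter_upwards [ae_summable_angularFourier hε u] with ξ hξ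
  exact (enorm_fiber_sq hξ).symm

theorem lintegral_enorm_fiber_sq (hε : 0 < ε) (u : L2 d) :
    ∫⁻ ξ, ‖fiber ε u ξ‖ₑ ^ 2 ∂dualMeasure d ε = ENNReal.ofReal (‖u‖ ^ 2) := by
  have hpos := cellVol_pos d
  calc ∫⁻ ξ, ‖fiber ε u ξ‖ₑ ^ 2 ∂dualMeasure d ε
      = ∫⁻ ξ, ENNReal.ofReal (cellVol d)⁻¹ *
          ∑' n, ‖angularFourier u (ξ + latticePoint ε n)‖ₑ ^ 2 ∂dualMeasure d ε := by
        refine lintegral_congr_ae ?_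
        filter_upwards [ae_summable_angularFourier hε u] with ξ hξ
        exact enorm_fiber_sq hξ
    _ = ENNReal.ofReal (‖u‖ ^ 2) := by
        rw [lintegral_const_mul' _ _ ENNReal.ofReal_ne_top, lintegral_tsum_angularFourier hε,
          ← ENNReal.ofReal_mul (inv_pos.mpr hpos).le, inv_mul_cancel_left₀ hpos.ne']

theorem integrable_norm_fiber_sq (hε : 0 < ε) (u : L2 d) :
    Integrable (fun ξ => ‖fiber ε u ξ‖ ^ 2) (dualMeasure d ε) := by
  have hfinite : ∫⁻ ξ, ‖fiber ε u ξ‖ₑ ^ 2 ∂dualMeasure d ε ≠ ⊤ := by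
    rw [lintegral_enorm_fiber_sq hε]
    exact ENNReal.ofReal_ne_top
  simpa using integrable_toReal_of_lintegral_ne_top (aemeasurable_enorm_fiber_sq hε u) hfinite

theorem integral_norm_fiber_sq (hε : 0 < ε) (u : L2 d) :
    ∫ ξ, ‖fiber ε u ξ‖ ^ 2 ∂dualMeasure d ε = ‖u‖ ^ 2 := by
  rw [integral_eq_lintegral_of_nonneg_ae (Eventually.of_forall fun ξ => by positivity)
    (integrable_norm_fiber_sq hε u).1]
  simp only [← enorm_sq_eq_ofReal]
  rw [lintegral_enorm_fiber_sq hε, ENNReal.toReal_ofReal (by positivity)]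

lemma fourierCoeffPer_fiber {u : L2 d} {ξ : E d}
    (h : Summable fun n => ‖angularFourier u (ξ + latticePoint ε n)‖ ^ 2) (n : Fin d → ℤ) :
    fourierCoeffPer (fiber ε u ξ) n =
      (cellVol d : ℂ)⁻¹ * angularFourier u (ξ + latticePoint ε n) :=
  fourierCoeffPer_fourierSeries (summable_const_mul_norm_sq _ h) n

theorem hasSum_blochCoeff {φ : E d → E d → ℂ} {u : L2 d} {ξ : E d}
    (h : Summable fun n => ‖angularFourier u (ξ + latticePoint ε n)‖ ^ 2)
    (hφ : MemLp (fun y => φ y (ε • ξ)) 2 (cellMeasure d)) :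
    HasSum (fun n => angularFourier u (ξ + latticePoint ε n) *
      conj (fourierCoeffPer (fun y => φ y (ε • ξ)) n)) (blochCoeff ε φ u ξ) := by
  refine (hasSum_fourierCoeffPer_mul_conj (Lp.memLp (fiber ε u ξ)) hφ).congr_fun fun n => ?_
  rw [fourierCoeffPer_fiber h]
  field_simp [cellVol_ne_zero d]

lemma blochCoeff_add (hε : 0 < ε) {φ : E d → E d → ℂ}
    (hφ : ∀ η ∈ dualCell d, MemLp (fun y => φ y η) 2 (cellMeasure d)) (u v : L2 d) :
    ∀ᵐ ξ ∂dualMeasure d ε,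
      blochCoeff ε φ (u + v) ξ = blochCoeff ε φ u ξ + blochCoeff ε φ v ξ := by
  filter_upwards [ae_summable_angularFourier hε u, ae_summable_angularFourier hε v,
    ae_summable_angularFourier hε (u + v), ae_forall_add_latticePoint ε (angularFourier_add u v),
    ae_mem_scaledDualCell d ε] with ξ hu hv huv hadd hξ
  refine (hasSum_blochCoeff huv (hφ _ hξ)).unique ?_
  refine ((hasSum_blochCoeff hu (hφ _ hξ)).add (hasSum_blochCoeff hv (hφ _ hξ))).congr_fun
    fun n => ?_
  rw [hadd, add_mul]

lemma blochCoeff_smul (hε : 0 < ε) {φ : E d → E d → ℂ}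
    (hφ : ∀ η ∈ dualCell d, MemLp (fun y => φ y η) 2 (cellMeasure d)) (a : ℂ) (u : L2 d) :
    ∀ᵐ ξ ∂dualMeasure d ε, blochCoeff ε φ (a • u) ξ = a * blochCoeff ε φ u ξ := by
  filter_upwards [ae_summable_angularFourier hε u, ae_summable_angularFourier hε (a • u),
    ae_forall_add_latticePoint ε (angularFourier_smul a u), ae_mem_scaledDualCell d ε]
    with ξ hu hau hsmul hξ
  refine (hasSum_blochCoeff hau (hφ _ hξ)).unique ?_
  refine ((hasSum_blochCoeff hu (hφ _ hξ)).mul_left a).congr_fun fun n => ?_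
  rw [hsmul, mul_assoc]

theorem blochCoeff_toLp (hε : 0 < ε) {φ : E d → E d → ℂ}
    (hφ : ∀ η ∈ dualCell d, MemH2Per (fun y => φ y η)) {h : E d → ℂ} (hh : MemLp h 2) {R : ℝ}
    (hsupp : ∀ x ∉ Metric.ball 0 R, h x = 0) :
    ∀ᵐ ξ ∂dualMeasure d ε, blochCoeff ε φ (hh.toLp h) ξ =
      ∫ x, h x * conj (planeWave x ξ) * conj (scaledMode ε φ x ξ) := by
  have hint : Integrable h := by
    have := isFiniteMeasure_ball d R
    refine (integrableOn_iff_integrable_of_support_subset (s := Metric.ball 0 R) ?_).mp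
      ((hh.restrict _).integrable one_le_two)
    exact fun x hx => by_contra fun hxR => hx (hsupp x hxR)
  filter_upwards [ae_summable_angularFourier hε (hh.toLp h), ae_mem_scaledDualCell d ε,
    ae_forall_add_latticePoint ε (angularFourier_toLp_ae_eq hint hh)] with ξ hsum hξ hfourier
  rw [← setIntegral_eq_integral_of_forall_compl_eq_zero (s := Metric.ball 0 R)
    fun x hx => by simp [hsupp x hx]]
  refine (hasSum_blochCoeff hsum (hφ _ hξ).memLp).unique ?_
  refine (hasSum_integral_ball_mul_conj hε (hh.restrict _) (hφ _ hξ) ξ).congr_fun fun n => ?_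
  rw [hfourier n, setIntegral_eq_integral_of_forall_compl_eq_zero
    fun x hx => by simp [hsupp x hx]]

end Fiber

section Truncate

variable {d : ℕ} {ε : ℝ}

lemma memLp_indicator_ball (u : L2 d) (R : ℝ) :
    MemLp ((Metric.ball (0 : E d) R).indicator u) 2 volume :=
  (Lp.memLp u).indicator measurableSet_ball

/-- The restriction of `u ∈ L²(ℝ^d)` to a ball, extended by zero. -/
def truncate (u : L2 d) (R : ℝ) : L2 d := (memLp_indicator_ball u R).toLp _

lemma enorm_truncate_sub_sq (u : L2 d) (R : ℝ) :
    ‖truncate u R - u‖ₑ ^ 2 = ∫⁻ x in (Metric.ball (0 : E d) R)ᶜ, ‖u x‖ₑ ^ 2 := by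
  rw [enorm_sq_eq_ofReal, ← lintegral_enorm_sq_Lp, ← lintegral_indicator measurableSet_ball.compl]
  refine lintegral_congr_ae ?_
  filter_upwards [Lp.coeFn_sub (truncate u R) u, (memLp_indicator_ball u R).coeFn_toLp]
    with x hsub htrunc
  rw [hsub, Pi.sub_apply, truncate, htrunc]
  by_cases hx : x ∈ Metric.ball (0 : E d) R <;> simp [hx]

theorem tendsto_truncate (u : L2 d) : Tendsto (truncate u) atTop (𝓝 u) := by
  have hsq : Tendsto (fun R => ‖truncate u R - u‖ₑ ^ 2) atTop (𝓝 0) := by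
    simp only [enorm_truncate_sub_sq]
    refine tendsto_setLIntegral_compl_ball
      ((Lp.aestronglyMeasurable u).enorm.pow_const 2) ?_ 0
    rw [lintegral_enorm_sq_Lp]
    exact ENNReal.ofReal_ne_top
  rw [tendsto_iff_edist_tendsto_0]
  have hroot := hsq.ennrpow_const (2 : ℝ)⁻¹
  simpa only [edist_eq_enorm_sub, ← ENNReal.rpow_natCast, ← ENNReal.rpow_mul, Nat.cast_ofNat,
    mul_inv_cancel₀ (two_ne_zero' ℝ), ENNReal.rpow_one,
    ENNReal.zero_rpow_of_pos (inv_pos.mpr (two_pos (α := ℝ)))] using hroot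

theorem blochCoeff_truncate (hε : 0 < ε) {φ : E d → E d → ℂ}
    (hφ : ∀ η ∈ dualCell d, MemH2Per (fun y => φ y η)) (u : L2 d) (R : ℝ) :
    ∀ᵐ ξ ∂dualMeasure d ε, blochCoeff ε φ (truncate u R) ξ =
      ∫ x in Metric.ball 0 R, u x * conj (planeWave x ξ) * conj (scaledMode ε φ x ξ) := by
  filter_upwards [blochCoeff_toLp hε hφ (memLp_indicator_ball u R)
    fun x hx => Set.indicator_of_notMem hx _] with ξ hξ
  rw [truncate, hξ, ← integral_indicator measurableSet_ball]
  simp only [Set.indicator_mul_left]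

end Truncate

section BlochCoefficients

variable {d : ℕ} {ε ρ : ℝ} {A : E d → Matrix (Fin d) (Fin d) ℝ} {lam : ℕ → E d → ℝ}
  {φ : ℕ → E d → E d → ℂ}

lemma quasiMeasurePreserving_smul_scaledDualCell (hε : 0 < ε) :
    Measure.QuasiMeasurePreserving (fun ξ : E d => ε • ξ)
      (dualMeasure d ε) (volume.restrict (dualCell d)) :=
  (Measure.quasiMeasurePreserving_smul volume hε.ne').restrict fun _ h => h

lemma IsBlochSystem.aestronglyMeasurable_smul (hB : IsBlochSystem A ρ lam φ) (hε : 0 < ε)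
    (m : ℕ) : AEStronglyMeasurable (fun z : E d × E d => φ m z.1 (ε • z.2))
      ((cellMeasure d).prod (dualMeasure d ε)) :=
  (hB.measurable m).comp_quasiMeasurePreserving (QuasiMeasurePreserving.prodMap
    (⟨measurable_id, by simpa using Measure.restrict_le_self.absolutelyContinuous⟩)
    (quasiMeasurePreserving_smul_scaledDualCell hε))

lemma IsBlochSystem.aestronglyMeasurable_scaledMode (hB : IsBlochSystem A ρ lam φ) (hε : 0 < ε)
    (m : ℕ) : AEStronglyMeasurable (fun z : E d × E d => scaledMode ε (φ m) z.1 z.2)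
      (volume.prod (dualMeasure d ε)) :=
  (hB.measurable m).comp_quasiMeasurePreserving (QuasiMeasurePreserving.prodMap
    (Measure.quasiMeasurePreserving_smul volume (inv_ne_zero hε.ne'))
    (quasiMeasurePreserving_smul_scaledDualCell hε))

lemma IsBlochSystem.aestronglyMeasurable_fourierCoeffPer (hB : IsBlochSystem A ρ lam φ)
    (hε : 0 < ε) (m : ℕ) (n : Fin d → ℤ) :
    AEStronglyMeasurable (fun ξ => fourierCoeffPer (fun y => φ m y (ε • ξ)) n)
      (dualMeasure d ε) := by
  have hjoint := (hB.aestronglyMeasurable_smul hε m).mul (Complex.continuous_conj.comp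
    ((continuous_expMode n).comp continuous_fst)).aestronglyMeasurable
  exact hjoint.prod_swap.integral_prod_right'.const_mul _

lemma IsBlochSystem.aestronglyMeasurable_blochCoeff (hB : IsBlochSystem A ρ lam φ)
    (hε : 0 < ε) (m : ℕ) (u : L2 d) :
    AEStronglyMeasurable (blochCoeff ε (φ m) u) (dualMeasure d ε) := by
  refine aestronglyMeasurable_of_tendsto_ae (u := (atTop : Filter (Finset (Fin d → ℤ))))
    (f := fun s ξ => ∑ n ∈ s, angularFourier u (ξ + latticePoint ε n) *
      conj (fourierCoeffPer (fun y => φ m y (ε • ξ)) n)) (fun s => ?_) ?_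
  · refine Finset.aestronglyMeasurable_fun_sum s fun n _ => ?_
    exact (aestronglyMeasurable_angularFourier_add ε u n).mul
      (Complex.continuous_conj.comp_aestronglyMeasurable
        (hB.aestronglyMeasurable_fourierCoeffPer hε m n))
  · filter_upwards [ae_summable_angularFourier hε u, ae_mem_scaledDualCell d ε] with ξ hsum hξ
    exact hasSum_blochCoeff hsum (hB.memH2 _ hξ m).memLp

lemma IsBlochSystem.blochCoeff_eq_inner (hB : IsBlochSystem A ρ lam φ) {ξ : E d}
    (hξ : ε • ξ ∈ dualCell d) (m : ℕ) (u : L2 d) :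
    blochCoeff ε (φ m) u ξ = inner ℂ (h2PerToLp d (hB.mode hξ m)) (fiber ε u ξ) := by
  conv_rhs => rw [← Lp.toLp_coeFn (fiber ε u ξ) (Lp.memLp _)]
  exact (inner_toLp (hB.mode hξ m).2.memLp (Lp.memLp (fiber ε u ξ))).symm

lemma IsBlochSystem.sum_norm_blochCoeff_sq_le_norm_fiber_sq (hB : IsBlochSystem A ρ lam φ)
    {ξ : E d} (hξ : ε • ξ ∈ dualCell d) (s : Finset ℕ) (u : L2 d) :
    ∑ m ∈ s, ‖blochCoeff ε (φ m) u ξ‖ ^ 2 ≤ ‖fiber ε u ξ‖ ^ 2 := by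
  simp only [hB.blochCoeff_eq_inner hξ]
  exact (hB.orthonormal_mode hξ).sum_inner_products_le _

lemma IsBlochSystem.memLp_blochCoeff (hB : IsBlochSystem A ρ lam φ) (hε : 0 < ε) (m : ℕ)
    (u : L2 d) : MemLp (blochCoeff ε (φ m) u) 2 (dualMeasure d ε) := by
  have hmeas := hB.aestronglyMeasurable_blochCoeff hε m u
  refine (memLp_two_iff_integrable_sq_norm hmeas).mpr
    ((integrable_norm_fiber_sq hε u).mono' (hmeas.norm.pow 2) ?_)
  filter_upwards [ae_mem_scaledDualCell d ε] with ξ hξ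
  simpa using hB.sum_norm_blochCoeff_sq_le_norm_fiber_sq hξ {m} u

lemma IsBlochSystem.integrable_norm_blochCoeff_sq (hB : IsBlochSystem A ρ lam φ) (hε : 0 < ε)
    (m : ℕ) (u : L2 d) : Integrable (fun ξ => ‖blochCoeff ε (φ m) u ξ‖ ^ 2) (dualMeasure d ε) :=
  (memLp_two_iff_integrable_sq_norm (hB.aestronglyMeasurable_blochCoeff hε m u)).mp
    (hB.memLp_blochCoeff hε m u)

theorem IsBlochSystem.sum_integral_norm_blochCoeff_sq_le (hB : IsBlochSystem A ρ lam φ)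
    (hε : 0 < ε) (s : Finset ℕ) (u : L2 d) :
    ∑ m ∈ s, ∫ ξ, ‖blochCoeff ε (φ m) u ξ‖ ^ 2 ∂dualMeasure d ε ≤ ‖u‖ ^ 2 := by
  have hint := fun m (_ : m ∈ s) => hB.integrable_norm_blochCoeff_sq hε m u
  rw [← integral_finsetSum s hint, ← integral_norm_fiber_sq hε]
  refine integral_mono_ae (integrable_finsetSum s hint) (integrable_norm_fiber_sq hε u) ?_
  filter_upwards [ae_mem_scaledDualCell d ε] with ξ hξ
  exact hB.sum_norm_blochCoeff_sq_le_norm_fiber_sq hξ s u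

lemma norm_toLp_sq {X : Type*} [MeasurableSpace X] {μ : Measure X} {f : X → ℂ}
    (hf : MemLp f 2 μ) : ‖hf.toLp f‖ ^ 2 = ∫ x, ‖f x‖ ^ 2 ∂μ := by
  rw [norm_Lp_sq]
  refine integral_congr_ae ?_
  filter_upwards [hf.coeFn_toLp] with x hx
  rw [hx]

/-- The Bloch transform for the `m`-th mode, `u ↦ blochCoeff ε (φ m) u`, as a contraction from
`L²(ℝ^d)` to `L²(ε⁻¹ Y')`. -/
def IsBlochSystem.transform (hB : IsBlochSystem A ρ lam φ) (hε : 0 < ε) (m : ℕ) :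
    L2 d →L[ℂ] Lp ℂ 2 (dualMeasure d ε) :=
  LinearMap.mkContinuous
    { toFun := fun u => (hB.memLp_blochCoeff hε m u).toLp _
      map_add' := fun u v => by
        rw [← MemLp.toLp_add]
        exact MemLp.toLp_congr _ _
          (blochCoeff_add hε (fun η hη => (hB.memH2 η hη m).memLp) u v)
      map_smul' := fun a u => by
        rw [RingHom.id_apply, ← MemLp.toLp_const_smul]
        exact MemLp.toLp_congr _ _
          (blochCoeff_smul hε (fun η hη => (hB.memH2 η hη m).memLp) a u) }
    1
    (fun u => by
      rw [one_mul]
      refine (pow_le_pow_iff_left₀ (norm_nonneg _) (norm_nonneg _) two_ne_zero).mp ?_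
      change ‖(hB.memLp_blochCoeff hε m u).toLp _‖ ^ 2 ≤ _
      rw [norm_toLp_sq]
      simpa using hB.sum_integral_norm_blochCoeff_sq_le hε {m} u)

lemma IsBlochSystem.coeFn_transform (hB : IsBlochSystem A ρ lam φ) (hε : 0 < ε) (m : ℕ)
    (u : L2 d) : hB.transform hε m u =ᵐ[dualMeasure d ε] blochCoeff ε (φ m) u :=
  (hB.memLp_blochCoeff hε m u).coeFn_toLp

lemma IsBlochSystem.norm_transform_sq (hB : IsBlochSystem A ρ lam φ) (hε : 0 < ε) (m : ℕ)
    (u : L2 d) :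
    ‖hB.transform hε m u‖ ^ 2 = ∫ ξ, ‖blochCoeff ε (φ m) u ξ‖ ^ 2 ∂dualMeasure d ε :=
  norm_toLp_sq (hB.memLp_blochCoeff hε m u)

theorem IsBlochSystem.sum_norm_transform_sq_le (hB : IsBlochSystem A ρ lam φ) (hε : 0 < ε)
    (s : Finset ℕ) (u : L2 d) : ∑ m ∈ s, ‖hB.transform hε m u‖ ^ 2 ≤ ‖u‖ ^ 2 := by
  simpa only [hB.norm_transform_sq hε] using hB.sum_integral_norm_blochCoeff_sq_le hε s u

theorem IsBlochSystem.isBlochCoeff_transform (hB : IsBlochSystem A ρ lam φ) (hε : 0 < ε)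
    (m : ℕ) (u : L2 d) : IsBlochCoeff ε (φ m) u (hB.transform hε m u) := by
  refine ⟨Lp.memLp _, ?_⟩
  have hlim := ((hB.transform hε m).continuous.tendsto u).comp (tendsto_truncate u)
  refine ((Lp.tendsto_Lp_iff_tendsto_eLpNorm' _ _).mp hlim).congr fun R => eLpNorm_congr_ae ?_
  filter_upwards [hB.coeFn_transform hε m (truncate u R),
    blochCoeff_truncate hε (fun η hη => hB.memH2 η hη m) u R] with ξ hcoe hξ
  rw [Pi.sub_apply, Function.comp_apply, hcoe, hξ]

end BlochCoefficients

/-! ### The energy estimate -/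

section Energy

variable {d : ℕ} {α β ε κ : ℝ} {A : E d → Matrix (Fin d) (Fin d) ℝ} {lam : ℕ → E d → ℝ}
  {φ : ℕ → E d → E d → ℂ} {u L : L2 d} {G : Fin d → L2 d} {ξ : E d}

lemma intCast_add_smul_apply (hε : ε ≠ 0) (ξ : E d) (n : Fin d → ℤ) (j : Fin d) :
    (n j : ℝ) + (ε • ξ) j = ε * (ξ + latticePoint ε n) j := by
  simp only [latticePoint, PiLp.add_apply, PiLp.smul_apply, smul_eq_mul]
  field_simp
  ring

lemma one_add_sum_intCast_sq_le (hε : ε ≠ 0) (ξ : E d) (n : Fin d → ℤ) :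
    1 + ∑ j, (n j : ℝ) ^ 2 ≤ (1 + 2 * ∑ j, (ε * ξ j) ^ 2) +
      2 * ε ^ 2 * ∑ j, (ξ + latticePoint ε n) j ^ 2 := by
  rw [add_assoc, Finset.mul_sum, Finset.mul_sum, ← Finset.sum_add_distrib]
  gcongr with j
  have hn : (n j : ℝ) = ε * (ξ + latticePoint ε n) j - ε * ξ j :=
    eq_sub_of_add_eq (intCast_add_smul_apply hε ξ n j)
  rw [hn]
  nlinarith only [sq_nonneg (ε * (ξ + latticePoint ε n) j + ε * ξ j)]

lemma summable_one_add_sq_sq_mul_angularFourier (hε : ε ≠ 0)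
    (hu : Summable fun n => ‖angularFourier u (ξ + latticePoint ε n)‖ ^ 2)
    (hL : Summable fun n => ‖angularFourier L (ξ + latticePoint ε n)‖ ^ 2)
    (hLu : ∀ n : Fin d → ℤ, angularFourier L (ξ + latticePoint ε n) =
      -((∑ j, (ξ + latticePoint ε n) j ^ 2 : ℝ) : ℂ) * angularFourier u (ξ + latticePoint ε n)) :
    Summable fun n : Fin d → ℤ =>
      (1 + ∑ j, (n j : ℝ) ^ 2) ^ 2 * ‖angularFourier u (ξ + latticePoint ε n)‖ ^ 2 := by
  set a := 1 + 2 * ∑ j, (ε * ξ j) ^ 2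
  refine Summable.of_nonneg_of_le (fun n => by positivity) (fun n => ?_)
    ((hu.mul_left (2 * a ^ 2)).add (hL.mul_left (2 * (2 * ε ^ 2) ^ 2)))
  set s := ∑ j, (ξ + latticePoint ε n) j ^ 2
  have hs : 0 ≤ s := by positivity
  rw [hLu n, norm_mul, norm_neg, Complex.norm_real, Real.norm_of_nonneg hs, mul_pow s,
    ← mul_assoc, ← add_mul]
  gcongr
  calc (1 + ∑ j, (n j : ℝ) ^ 2) ^ 2 ≤ (a + 2 * ε ^ 2 * s) ^ 2 :=
        pow_le_pow_left₀ (by positivity) (one_add_sum_intCast_sq_le hε ξ n) 2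
    _ ≤ 2 * a ^ 2 + 2 * (2 * ε ^ 2) ^ 2 * s ^ 2 := by
        nlinarith only [sq_nonneg (a - 2 * ε ^ 2 * s)]

/-- The fiber of `u` at `ξ` as an everywhere defined periodic function. -/
def periodicFiber (ε : ℝ) (u : L2 d) (ξ y : E d) : ℂ := fiber ε u ξ (cellFract y)

lemma fourierCoeffPer_periodicFiber
    (hu : Summable fun n => ‖angularFourier u (ξ + latticePoint ε n)‖ ^ 2) (n : Fin d → ℤ) :
    fourierCoeffPer (periodicFiber ε u ξ) n =
      (cellVol d : ℂ)⁻¹ * angularFourier u (ξ + latticePoint ε n) :=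
  (fourierCoeffPer_congr (comp_cellFract_ae_eq _) n).trans (fourierCoeffPer_fiber hu n)

lemma memH2Per_periodicFiber (hε : ε ≠ 0)
    (hu : Summable fun n => ‖angularFourier u (ξ + latticePoint ε n)‖ ^ 2)
    (hL : Summable fun n => ‖angularFourier L (ξ + latticePoint ε n)‖ ^ 2)
    (hLu : ∀ n : Fin d → ℤ, angularFourier L (ξ + latticePoint ε n) =
      -((∑ j, (ξ + latticePoint ε n) j ^ 2 : ℝ) : ℂ) * angularFourier u (ξ + latticePoint ε n)) :
    MemH2Per (periodicFiber ε u ξ) := by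
  refine memH2Per_comp_cellFract (Lp.memLp _) ?_
  refine ((summable_one_add_sq_sq_mul_angularFourier hε hu hL hLu).mul_left
    (‖(cellVol d : ℂ)⁻¹‖ ^ 2)).congr fun n => ?_
  rw [fourierCoeffPer_fiber hu, norm_mul]
  ring

lemma h2PerToLp_periodicFiber (h : MemH2Per (periodicFiber ε u ξ)) :
    h2PerToLp d ⟨periodicFiber ε u ξ, h⟩ = fiber ε u ξ :=
  (MemLp.toLp_congr h.memLp (Lp.memLp _) (comp_cellFract_ae_eq _)).trans (Lp.toLp_coeFn _ _)

lemma shiftedPartial_periodicFiber (hε : ε ≠ 0) {g : L2 d} {j : Fin d}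
    (hu : Summable fun n => ‖angularFourier u (ξ + latticePoint ε n)‖ ^ 2)
    (hg : Summable fun n => ‖angularFourier g (ξ + latticePoint ε n)‖ ^ 2)
    (hgu : ∀ n : Fin d → ℤ, angularFourier g (ξ + latticePoint ε n) =
      Complex.I * ((ξ + latticePoint ε n) j : ℂ) * angularFourier u (ξ + latticePoint ε n)) :
    shiftedPartial (ε • ξ) j (periodicFiber ε u ξ) = (ε : ℂ) • fiber ε g ξ := by
  rw [shiftedPartial, fiber, ← fourierSeries_smul _ (summable_const_mul_norm_sq _ hg)]
  congr 1
  ext n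
  rw [fourierCoeffPer_periodicFiber hu, intCast_add_smul_apply hε, hgu]
  push_cast
  ring

lemma shiftedLaplacian_periodicFiber (hε : ε ≠ 0)
    (hu : Summable fun n => ‖angularFourier u (ξ + latticePoint ε n)‖ ^ 2)
    (hL : Summable fun n => ‖angularFourier L (ξ + latticePoint ε n)‖ ^ 2)
    (hLu : ∀ n : Fin d → ℤ, angularFourier L (ξ + latticePoint ε n) =
      -((∑ j, (ξ + latticePoint ε n) j ^ 2 : ℝ) : ℂ) * angularFourier u (ξ + latticePoint ε n)) :
    shiftedLaplacian (ε • ξ) (periodicFiber ε u ξ) = ((ε ^ 2 : ℝ) : ℂ) • fiber ε L ξ := by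
  rw [shiftedLaplacian, fiber, ← fourierSeries_smul _ (summable_const_mul_norm_sq _ hL)]
  congr 1
  ext n
  simp only [fourierCoeffPer_periodicFiber hu, intCast_add_smul_apply hε, hLu, mul_pow,
    ← Finset.mul_sum]
  push_cast
  ring

theorem IsBlochSystem.ae_sum_norm_blochCoeff_sq_le (hA : IsAdmissible α β A) (hε : 0 < ε)
    (hB : IsBlochSystem A (κ / ε) lam φ) (hG : ∀ j, IsPartial j u (G j)) (hL : IsLaplacian u L)
    (N : ℕ) :
    ∀ᵐ ξ ∂dualMeasure d ε, ∑ m ∈ Finset.Icc 1 N, ‖blochCoeff ε (φ m) u ξ‖ ^ 2 ≤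
      4 / α * ε ^ 2 * (|β| * d * ∑ j, ‖fiber ε (G j) ξ‖ ^ 2 + κ ^ 2 * ‖fiber ε L ξ‖ ^ 2) := by
  filter_upwards [ae_mem_scaledDualCell d ε, ae_summable_angularFourier hε u,
    ae_all_iff.mpr fun j => ae_summable_angularFourier hε (G j),
    ae_summable_angularFourier hε L,
    ae_all_iff.mpr fun j => ae_forall_add_latticePoint ε (hG j).angularFourier_ae_eq,
    ae_forall_add_latticePoint ε hL.angularFourier_ae_eq]
    with ξ hξ hu_sum hG_sum hL_sum hGu hLu
  have hmem := memH2Per_periodicFiber hε.ne' hu_sum hL_sum hLu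
  have hgap := hB.sum_norm_inner_mode_sq_le hA hξ ⟨periodicFiber ε u ξ, hmem⟩ N
  simp only [h2PerToLp_periodicFiber, ← hB.blochCoeff_eq_inner hξ,
    shiftedPartial_periodicFiber hε.ne' hu_sum (hG_sum _) (hGu _),
    shiftedLaplacian_periodicFiber hε.ne' hu_sum hL_sum hLu, norm_smul, Complex.norm_real,
    Real.norm_eq_abs, mul_pow, sq_abs, ← Finset.mul_sum] at hgap
  refine hgap.trans_eq ?_
  field_simp

theorem IsBlochSystem.sum_norm_transform_sq_le_energy (hA : IsAdmissible α β A) (hε : 0 < ε)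
    (hB : IsBlochSystem A (κ / ε) lam φ) (hG : ∀ j, IsPartial j u (G j)) (hL : IsLaplacian u L)
    (N : ℕ) :
    ∑ m ∈ Finset.Icc 1 N, ‖hB.transform hε m u‖ ^ 2 ≤
      4 / α * ε ^ 2 * (|β| * d * ∑ j, ‖G j‖ ^ 2 + κ ^ 2 * ‖L‖ ^ 2) := by
  have hB_int := fun m (_ : m ∈ Finset.Icc 1 N) => hB.integrable_norm_blochCoeff_sq hε m u
  have hG_int := fun j (_ : j ∈ Finset.univ) => integrable_norm_fiber_sq hε (G j)
  have hL_int := integrable_norm_fiber_sq hε L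
  have hG_sum := (integrable_finsetSum _ hG_int).const_mul (|β| * d)
  simp only [hB.norm_transform_sq hε, ← integral_norm_fiber_sq hε (G _),
    ← integral_norm_fiber_sq hε L]
  rw [← integral_finsetSum _ hB_int, ← integral_finsetSum _ hG_int, ← integral_const_mul,
    ← integral_const_mul, ← integral_add hG_sum (hL_int.const_mul _), ← integral_const_mul]
  exact integral_mono_ae (integrable_finsetSum _ hB_int)
    ((hG_sum.add (hL_int.const_mul _)).const_mul _)
    (hB.ae_sum_norm_blochCoeff_sq_le hA hε hG hL N)

end Energy

/-! ### The adjoint of the Bloch transform -/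

section AdjointSeries

open ContinuousLinearMap

variable {𝕜 ι H K : Type*} [RCLike 𝕜] [NormedAddCommGroup H] [InnerProductSpace 𝕜 H]
  [CompleteSpace H] [NormedAddCommGroup K] [InnerProductSpace 𝕜 K] [CompleteSpace K]
  {T : ι → H →L[𝕜] K}

theorem norm_sum_adjoint_sq_le (hT : ∀ (s : Finset ι) (u : H), ∑ i ∈ s, ‖T i u‖ ^ 2 ≤ ‖u‖ ^ 2)
    (s : Finset ι) (b : ι → K) : ‖∑ i ∈ s, adjoint (T i) (b i)‖ ^ 2 ≤ ∑ i ∈ s, ‖b i‖ ^ 2 := by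
  set w := ∑ i ∈ s, adjoint (T i) (b i) with hw
  have hle : ‖w‖ ^ 2 ≤ (∑ i ∈ s, ‖b i‖ ^ 2 + ‖w‖ ^ 2) / 2 :=
    calc ‖w‖ ^ 2 = ∑ i ∈ s, RCLike.re (inner 𝕜 (b i) (T i w)) := by
          rw [← inner_self_eq_norm_sq (𝕜 := 𝕜), hw, sum_inner, map_sum, ← hw]
          simp only [adjoint_inner_left]
      _ ≤ ∑ i ∈ s, (‖b i‖ ^ 2 + ‖T i w‖ ^ 2) / 2 := by
          gcongr with i
          linarith only [re_inner_le_norm (𝕜 := 𝕜) (b i) (T i w),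
            two_mul_le_add_sq ‖b i‖ ‖T i w‖]
      _ ≤ (∑ i ∈ s, ‖b i‖ ^ 2 + ‖w‖ ^ 2) / 2 := by
          rw [← Finset.sum_div, Finset.sum_add_distrib]
          gcongr
          exact hT s w
  linarith only [hle]

theorem summable_adjoint (hT : ∀ (s : Finset ι) (u : H), ∑ i ∈ s, ‖T i u‖ ^ 2 ≤ ‖u‖ ^ 2)
    {b : ι → K} (hb : Summable fun i => ‖b i‖ ^ 2) : Summable fun i => adjoint (T i) (b i) := by
  rw [summable_iff_vanishing_norm] at hb ⊢
  intro δ hδ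
  obtain ⟨s, hs⟩ := hb (δ ^ 2) (by positivity)
  refine ⟨s, fun t ht => lt_of_pow_lt_pow_left₀ 2 hδ.le ?_⟩
  exact (norm_sum_adjoint_sq_le hT t b).trans_lt ((le_abs_self _).trans_lt (hs t ht))

end AdjointSeries

section Synthesis

open ContinuousLinearMap

variable {d : ℕ} {ε ρ : ℝ} {A : E d → Matrix (Fin d) (Fin d) ℝ} {lam : ℕ → E d → ℝ}
  {φ : ℕ → E d → E d → ℂ} {b : E d → ℂ}

lemma volume_scaledDualCell_lt_top (d : ℕ) (hε : 0 < ε) :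
    volume (scaledDualCell d ε) < ⊤ := by
  refine (measure_mono (t := Metric.closedBall (0 : E d)
    (Real.sqrt (∑ _j : Fin d, (ε⁻¹) ^ 2))) fun ξ hξ => ?_).trans_lt measure_closedBall_lt_top
  rw [mem_closedBall_zero_iff, EuclideanSpace.norm_eq]
  gcongr with j
  have hj := hξ j
  simp only [PiLp.smul_apply, smul_eq_mul, Set.mem_Ico] at hj
  rw [Real.norm_eq_abs, ← one_div, le_div_iff₀ hε, ← abs_of_pos hε, ← abs_mul, mul_comm, abs_le]
  constructor <;> linarith only [hj.1, hj.2]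

lemma isFiniteMeasure_dualMeasure (d : ℕ) (hε : 0 < ε) : IsFiniteMeasure (dualMeasure d ε) :=
  ⟨by simpa using volume_scaledDualCell_lt_top d hε⟩

lemma IsBlochSystem.eLpNorm_mode (hB : IsBlochSystem A ρ lam φ) {η : E d}
    (hη : η ∈ dualCell d) (m : ℕ) : eLpNorm (fun y => φ m y η) 2 (cellMeasure d) = 1 := by
  have hnorm : ‖(hB.memH2 η hη m).memLp.toLp _‖ = 1 := (hB.orthonormal_mode hη).1 m
  rwa [Lp.norm_toLp, ENNReal.toReal_eq_one_iff] at hnorm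

lemma IsBlochSystem.eLpNorm_scaledMode_le (hB : IsBlochSystem A ρ lam φ) (hε : 0 < ε)
    (R : ℝ) {ξ : E d} (hξ : ε • ξ ∈ dualCell d) (m : ℕ) :
    eLpNorm (fun x => scaledMode ε (φ m) x ξ) 2 (volume.restrict (Metric.ball 0 R)) ≤
      ballConst d ε R ^ (1 / 2 : ℝ) := by
  have hmode := hB.memH2 _ hξ m
  have hle := eLpNorm_comp_le_of_map_le (measurable_cellFract_smul d ε)
    (map_cellFract_smul_le d hε R) hmode.memLp.1
  rw [hB.eLpNorm_mode hξ, mul_one] at hle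
  exact (eLpNorm_congr_ae (ae_restrict_of_ae (hmode.ae_cellFract_smul_eq hε))).symm.trans_le hle

lemma IsBlochSystem.memLp_scaledMode (hB : IsBlochSystem A ρ lam φ) (hε : 0 < ε) (R : ℝ)
    (m : ℕ) : MemLp (fun z : E d × E d => scaledMode ε (φ m) z.1 z.2) 2
      ((volume.restrict (Metric.ball 0 R)).prod (dualMeasure d ε)) := by
  have hmeas := (hB.aestronglyMeasurable_scaledMode hε m).mono_measure
    (Measure.prod_mono (Measure.restrict_le_self (s := Metric.ball 0 R)) le_rfl)
  refine ⟨hmeas, ?_⟩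
  have := isFiniteMeasure_dualMeasure d hε
  have hsq : eLpNorm (fun z : E d × E d => scaledMode ε (φ m) z.1 z.2) 2
      ((volume.restrict (Metric.ball 0 R)).prod (dualMeasure d ε)) ^ 2 < ⊤ := by
    rw [eLpNorm_two_sq, lintegral_prod_symm _ (hmeas.enorm.pow_const 2)]
    refine (lintegral_mono_ae (g := fun _ => (ballConst d ε R ^ (1 / 2 : ℝ)) ^ 2) ?_).trans_lt ?_
    · filter_upwards [ae_mem_scaledDualCell d ε] with ξ hξ
      rw [← eLpNorm_two_sq fun x => scaledMode ε (φ m) x ξ]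
      gcongr
      exact hB.eLpNorm_scaledMode_le hε R hξ m
    · rw [lintegral_const]
      have := ballConst_ne_top d ε R
      finiteness
  exact (ENNReal.pow_lt_top_iff.mp hsq).resolve_right two_ne_zero

/-- The integrand of the contribution of the mode `φ`, with Bloch coefficient `b`, to the Bloch
expansion of a function. -/
def synthesisIntegrand (ε : ℝ) (φ : E d → E d → ℂ) (b : E d → ℂ) (x ξ : E d) : ℂ :=
  b ξ * scaledMode ε φ x ξ * planeWave x ξ

/-- The contribution `∫ b(ξ) φ(x/ε; εξ) e^{i x · ξ} dξ` of the mode `φ`, with Bloch coefficient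
`b`, to the Bloch expansion of a function. -/
def synthesis (ε : ℝ) (φ : E d → E d → ℂ) (b : E d → ℂ) (x : E d) : ℂ :=
  ∫ ξ in scaledDualCell d ε, synthesisIntegrand ε φ b x ξ

lemma IsBlochSystem.integrable_synthesisIntegrand (hB : IsBlochSystem A ρ lam φ) (hε : 0 < ε)
    (R : ℝ) (m : ℕ) (hb : MemLp b 2 (dualMeasure d ε)) :
    Integrable (Function.uncurry (synthesisIntegrand ε (φ m) b))
      ((volume.restrict (Metric.ball 0 R)).prod (dualMeasure d ε)) := by
  have := isFiniteMeasure_ball d R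
  have := isFiniteMeasure_dualMeasure d hε
  exact ((hb.comp_snd _).integrable_mul (hB.memLp_scaledMode hε R m)).mul_bdd (c := 1)
    continuous_planeWave.aestronglyMeasurable
    (Eventually.of_forall fun z => (norm_planeWave _ _).le)

lemma IsBlochSystem.ae_integrable_synthesisIntegrand (hB : IsBlochSystem A ρ lam φ) (hε : 0 < ε)
    (m : ℕ) (hb : MemLp b 2 (dualMeasure d ε)) :
    ∀ᵐ x : E d, Integrable (synthesisIntegrand ε (φ m) b x) (dualMeasure d ε) := by
  rw [← Measure.restrict_univ (μ := (volume : Measure (E d))), ← Metric.iUnion_ball_nat 0,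
    ae_restrict_iUnion_iff]
  exact fun R => (hB.integrable_synthesisIntegrand hε R m hb).prod_right_ae

lemma IsBlochSystem.locallyIntegrable_synthesis (hB : IsBlochSystem A ρ lam φ) (hε : 0 < ε)
    (m : ℕ) (hb : MemLp b 2 (dualMeasure d ε)) :
    LocallyIntegrable (synthesis ε (φ m) b) := by
  refine locallyIntegrable_iff.mpr fun s hs => ?_
  obtain ⟨R, hR⟩ := hs.isBounded.subset_ball 0
  have hball : IntegrableOn (synthesis ε (φ m) b) (Metric.ball 0 R) :=
    (hB.integrable_synthesisIntegrand hε R m hb).integral_prod_left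
  exact hball.mono_set hR

lemma IsBlochSystem.setIntegral_synthesis (hB : IsBlochSystem A ρ lam φ) (hε : 0 < ε) (m : ℕ)
    (hb : MemLp b 2 (dualMeasure d ε)) {s : Set (E d)} (hs : IsCompact s) :
    ∫ x in s, synthesis ε (φ m) b x = ∫ ξ in scaledDualCell d ε, b ξ * conj (blochCoeff ε (φ m)
      (indicatorConstLp 2 hs.measurableSet hs.measure_ne_top (1 : ℂ)) ξ) := by
  obtain ⟨R, hR⟩ := hs.isBounded.subset_ball 0
  have hint := (hB.integrable_synthesisIntegrand hε R m hb).mono_measure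
    (Measure.prod_mono (Measure.restrict_mono hR le_rfl) le_rfl)
  simp only [synthesis]
  rw [integral_integral_swap hint]
  refine integral_congr_ae ?_
  filter_upwards [blochCoeff_toLp hε (fun η hη => hB.memH2 η hη m)
    (memLp_indicator_const 2 hs.measurableSet (1 : ℂ) (Or.inr hs.measure_ne_top))
    fun x hx => Set.indicator_of_notMem (fun hxs => hx (hR hxs)) _] with ξ hξ
  rw [indicatorConstLp, hξ, ← integral_conj, ← integral_const_mul,
    ← integral_indicator hs.measurableSet]
  congr 1
  ext x
  by_cases hx : x ∈ s
  · simp only [Set.indicator_of_mem hx, synthesisIntegrand, map_mul, Complex.conj_conj,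
      one_mul]
    ring
  · simp [hx]

theorem IsBlochSystem.coeFn_adjoint_transform (hB : IsBlochSystem A ρ lam φ) (hε : 0 < ε)
    (m : ℕ) (b : Lp ℂ 2 (dualMeasure d ε)) :
    adjoint (hB.transform hε m) b =ᵐ[volume] synthesis ε (φ m) b := by
  have hadj : LocallyIntegrable (adjoint (hB.transform hε m) b) :=
    (Lp.memLp _).locallyIntegrable one_le_two
  have hsynth := hB.locallyIntegrable_synthesis hε m (Lp.memLp b)
  refine eventuallyEq_iff_sub.mpr
    (ae_eq_zero_of_forall_setIntegral_isCompact_eq_zero' (hadj.sub hsynth) fun s hs => ?_)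
  simp only [Pi.sub_apply]
  rw [integral_sub (hadj.integrableOn_isCompact hs) (hsynth.integrableOn_isCompact hs), sub_eq_zero,
    hB.setIntegral_synthesis hε m (Lp.memLp b) hs,
    ← L2.inner_indicatorConstLp_one (𝕜 := ℂ) hs.measurableSet hs.measure_ne_top,
    adjoint_inner_right, L2.inner_def]
  refine integral_congr_ae ?_
  filter_upwards [hB.coeFn_transform hε m (indicatorConstLp 2 hs.measurableSet hs.measure_ne_top 1)]
    with ξ hξ
  rw [hξ, RCLike.inner_apply]

lemma IsBlochSystem.coeFn_sum_adjoint_transform (hB : IsBlochSystem A ρ lam φ) (hε : 0 < ε)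
    (b : ℕ → Lp ℂ 2 (dualMeasure d ε)) (s : Finset ℕ) :
    ⇑(∑ m ∈ s, adjoint (hB.transform hε m) (b m)) =ᵐ[volume] fun x =>
      ∫ ξ in scaledDualCell d ε, ∑ m ∈ s, b m ξ * scaledMode ε (φ m) x ξ * planeWave x ξ := by
  filter_upwards [Lp.coeFn_fun_finsetSum s fun m => adjoint (hB.transform hε m) (b m),
    ae_all_iff.mpr fun m => hB.coeFn_adjoint_transform hε m (b m),
    ae_all_iff.mpr fun m => hB.ae_integrable_synthesisIntegrand hε m (Lp.memLp (b m))]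
    with x hsum hadj hint
  rw [hsum, Finset.sum_congr rfl fun m _ => hadj m]
  exact (integral_finsetSum s fun m _ => hint m).symm

theorem IsBlochSystem.exists_isHigherModePart (hB : IsBlochSystem A ρ lam φ) (hε : 0 < ε)
    {b : ℕ → Lp ℂ 2 (dualMeasure d ε)} {C : ℝ} (hC : 0 ≤ C)
    (hb : ∀ N, ∑ m ∈ Finset.Icc 1 N, ‖b m‖ ^ 2 ≤ C ^ 2) :
    ∃ v : L2 d, IsHigherModePart ε φ (fun m => b m) v ∧ ‖v‖ ≤ C := by
  have sum_Icc {F : Type} [AddCommMonoid F] (f : ℕ → F) (N : ℕ) :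
      ∑ m ∈ Finset.Icc 1 N, f m = ∑ m ∈ Finset.range N, f (m + 1) := by
    rw [← Finset.Ico_add_one_right_eq_Icc, Finset.sum_Ico_eq_sum_range]
    simp only [Nat.add_sub_cancel, add_comm]
  have hb_summable : Summable fun m => ‖b (m + 1)‖ ^ 2 :=
    summable_of_sum_range_le (c := C ^ 2) (fun m => by positivity) fun N => by
      simpa only [sum_Icc] using hb N
  have hsummable : Summable fun m => adjoint (hB.transform hε m) (b m) :=
    summable_adjoint (hB.sum_norm_transform_sq_le hε) ((summable_nat_add_iff 1).mp hb_summable)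
  have hlim : Tendsto (fun N => ∑ m ∈ Finset.Icc 1 N, adjoint (hB.transform hε m) (b m)) atTop
      (𝓝 (∑' m, adjoint (hB.transform hε (m + 1)) (b (m + 1)))) := by
    simp only [sum_Icc]
    exact ((summable_nat_add_iff 1).mpr hsummable).hasSum.tendsto_sum_nat
  refine ⟨_, ((Lp.tendsto_Lp_iff_tendsto_eLpNorm' _ _).mp hlim).congr fun N => ?_,
    le_of_tendsto hlim.norm (Eventually.of_forall fun N => ?_)⟩
  · refine eLpNorm_congr_ae ?_
    filter_upwards [hB.coeFn_sum_adjoint_transform hε b (Finset.Icc 1 N)] with x hx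
    rw [Pi.sub_apply, hx]
  · exact (pow_le_pow_iff_left₀ (norm_nonneg _) hC two_ne_zero).mp
      ((norm_sum_adjoint_sq_le (hB.sum_norm_transform_sq_le hε) _ b).trans (hb N))

end Synthesis

end

end BlochHom

theorem proposition8p1_general (d : ℕ) (α β M : ℝ) :
    ∃ c : ℝ, 0 < c ∧
      ∀ A : BlochHom.E d → Matrix (Fin d) (Fin d) ℝ, BlochHom.IsAdmissible α β A →
      ∀ ε κ : ℝ, 0 < ε → 0 ≤ κ →
      ∀ (lam : ℕ → BlochHom.E d → ℝ) (φ : ℕ → BlochHom.E d → BlochHom.E d → ℂ),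
        BlochHom.IsBlochSystem A (κ / ε) lam φ →
      ∀ (u : BlochHom.L2 d) (G : Fin d → BlochHom.L2 d) (L : BlochHom.L2 d),
        (∀ j, BlochHom.IsPartial j u (G j)) → BlochHom.IsLaplacian u L →
        ‖u‖ ^ 2 + ∑ j, ‖G j‖ ^ 2 ≤ M ^ 2 → κ * ‖L‖ ≤ M →
      ∃ (B : ℕ → BlochHom.E d → ℂ) (v : BlochHom.L2 d),
        (∀ m, BlochHom.IsBlochCoeff ε (φ m) u (B m)) ∧
        BlochHom.IsHigherModePart ε φ B v ∧
        ‖v‖ ≤ c * ε := by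
  set C := √(4 / α * ((|β| * d + 1) * M ^ 2))
  refine ⟨C + 1, by positivity, fun A hA ε κ hε hκ lam φ hB u G L hG hL hH1 hκL => ?_⟩
  have hG_le : ∑ j, ‖G j‖ ^ 2 ≤ M ^ 2 := (le_add_of_nonneg_left (by positivity)).trans hH1
  have hL_le : κ ^ 2 * ‖L‖ ^ 2 ≤ M ^ 2 := by
    rw [← mul_pow]
    exact pow_le_pow_left₀ (by positivity) hκL 2
  have hα := hA.pos
  have henergy (N : ℕ) : ∑ m ∈ Finset.Icc 1 N, ‖hB.transform hε m u‖ ^ 2 ≤ (C * ε) ^ 2 :=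
    calc ∑ m ∈ Finset.Icc 1 N, ‖hB.transform hε m u‖ ^ 2
        ≤ 4 / α * ε ^ 2 * (|β| * d * ∑ j, ‖G j‖ ^ 2 + κ ^ 2 * ‖L‖ ^ 2) :=
          hB.sum_norm_transform_sq_le_energy hA hε hG hL N
      _ ≤ 4 / α * ε ^ 2 * (|β| * d * M ^ 2 + M ^ 2) := by gcongr
      _ = (C * ε) ^ 2 := by
          rw [mul_pow, Real.sq_sqrt (by positivity)]
          ring
  obtain ⟨v, hv, hv_le⟩ := hB.exists_isHigherModePart hε (by positivity) henergy
  exact ⟨_, v, fun m => hB.isBlochCoeff_transform hε m u, hv,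
    hv_le.trans (mul_le_mul_of_nonneg_right (le_add_of_nonneg_right zero_le_one) hε.le)⟩

theorem proposition8p1 (d : ℕ) (α β M : ℝ) :
    ∃ c : ℝ, 0 < c ∧
      ∀ A : BlochHom.E d → Matrix (Fin d) (Fin d) ℝ, BlochHom.IsAdmissible α β A →
      ∀ ε κ : ℝ, 0 < ε → 0 < κ →
      ∀ (lam : ℕ → BlochHom.E d → ℝ) (φ : ℕ → BlochHom.E d → BlochHom.E d → ℂ),
        BlochHom.IsBlochSystem A (κ / ε) lam φ →
      ∀ f u : BlochHom.L2 d, BlochHom.IsSolution A κ ε f u →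
      ∀ (G : Fin d → BlochHom.L2 d) (L : BlochHom.L2 d),
        (∀ j, BlochHom.IsPartial j u (G j)) → BlochHom.IsLaplacian u L →
        ‖u‖ ^ 2 + ∑ j, ‖G j‖ ^ 2 ≤ M ^ 2 → κ * ‖L‖ ≤ M →
      ∃ (B : ℕ → BlochHom.E d → ℂ) (v : BlochHom.L2 d),
        (∀ m, BlochHom.IsBlochCoeff ε (φ m) u (B m)) ∧
        BlochHom.IsHigherModePart ε φ B v ∧
        ‖v‖ ≤ c * ε := by
  obtain ⟨c, hc, hbound⟩ := proposition8p1_general d α β M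
  exact ⟨c, hc, fun A hA ε κ hε hκ lam φ hB _ u _ => hbound A hA ε κ hε hκ.le lam φ hB u⟩
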